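/- For vertex-disjoint graphs $G_1,G_2$ let $G_1\cup G_2$ denote their disjoint union and $G_1\vee G_2$ their join (the graph obtained from $G_1\cup G_2$ by adding all edges between $V(G_1)$ and $V(G_2)$); let $tK_1$ denote the edgeless graph on $t$ vertices. For integers $n\ge c\ge 4$ and $1\le a<c/2$ put $$H_{n,c,a}=K_a\vee\bigl(K_{c-2a}\cup (n-c+a)K_1\bigr).$$ Let $k,n$ be integers with $3\le k+2\le n\le 2k+1$, and let $G$ be a finite simple graph with $n$ vertices and $$e(G)\ \ge\ \binom{k+1}{2}+\binom{n-k}{2}$$ edges. Then $G$ contains a cycle of length $\ell$ for every integer $\ell$ with $3\le \ell\le k+2$, unless $G$ is isomorphic to one of the following graphs: (i) $K_1\vee(K_k\cup K_{n-k-1})$, $K_{k,k}$, or $K_{k,k+1}$; (ii) $H_{\frac{3k+1}{2},\,k+2,\,\frac{k+1}{2}}$ or $H_{\frac{3k+3}{2},\,k+2,\,\frac{k+1}{2}}$, where $k\ge 3$ is odd. -/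

import Mathlib

open SimpleGraph

/-- The join `G ∨ H`: the disjoint union of `G` and `H` together with all edges between a vertex
of `G` and a vertex of `H`. -/
def graphJoin {V W : Type*} (G : SimpleGraph V) (H : SimpleGraph W) : SimpleGraph (V ⊕ W) :=
  (G ⊕g H) ⊔ completeBipartiteGraph V W

/-- `G` contains a cycle of length `l`. -/
def HasCycleOfLength {V : Type*} (G : SimpleGraph V) (l : ℕ) : Prop :=
  ∃ (v : V) (p : G.Walk v v), p.IsCycle ∧ p.length = l

/-- The graph `K_1 ∨ (K_r ∪ K_s)`: two complete graphs of orders `r + 1` and `s + 1` that share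
exactly one vertex. -/
def twoCliquesGraph (r s : ℕ) : SimpleGraph (Fin 1 ⊕ (Fin r ⊕ Fin s)) :=
  graphJoin (completeGraph (Fin 1)) (completeGraph (Fin r) ⊕g completeGraph (Fin s))

/-- The graph `H_{n,c,a} = K_a ∨ (K_{c-2a} ∪ (n-c+a) K_1)`, meant for `n ≥ c` and `c > 2a`, where
the subtractions do not truncate. `(n-c+a) K_1` is the edgeless graph on `n-c+a` vertices. -/
def kopylovGraph (n c a : ℕ) : SimpleGraph (Fin a ⊕ (Fin (c - 2 * a) ⊕ Fin (n - c + a))) :=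
  graphJoin (completeGraph (Fin a))
    (completeGraph (Fin (c - 2 * a)) ⊕g (⊥ : SimpleGraph (Fin (n - c + a))))

/-! Put x = n - k - 2 and count edges by degree sums, so that the hypothesis reads (k+1)k +
(x+2)(x+1) ≤ `degSum`. For x ≥ 1, deleting a vertex of degree at most x + 1 preserves the bound with
x - 1 for x, because (x+2)(x+1) - (x+1)x = 2(x+1). Induction on x (`hasCyc_or_exceptional`)
therefore leaves two tasks: graphs in which all degrees are at least n - k = x + 2, and putting a
vertex back into an exceptional graph. Exceptional graphs attain the bound, so the returning vertex
has degree exactly x + 1, and the three `extend` lemmas show that it either completes all the cycles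
or fits the pattern. For x = 0 a vertex of degree at most 1 hangs on a complete graph.

Under the degree condition the graph has no cut vertex (`noCutVertex_of_inDeg`), and Kopylov's
method applies (`exists_long_cyc_or_isCliqueJoin`). Add edges as long as no cycle of length at least
c = k + 2 appears; then nonadjacent vertices are ends of long paths. A long path whose ends have c
neighbours on it in total yields a long cycle (`NoCutVertex.exists_long_cyc_of_seq`), so sets with
large inner degrees are completely joined. Hence the graph is degenerate, or it is a clique with
vertices of small degree peeled off (`LongPathSaturated.degenerate_or`). Counting edges leaves only
the join of a clique and an edgeless graph.

Otherwise there is a cycle of length at least k + 2 > n/2. With more than n²/4 edges all shorter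
lengths follow (`hasCyc_of_dense`): vertices of degree below n/2 off a longest cycle are removed
until it is Hamiltonian, where Bondy's argument works (`IsCyc.pancyclic`). The density can fail only
for n = 2k. There the graph is Hamiltonian with minimum degree at least n/2, and either a cycle of
length n - 1 gives all lengths or the graph is balanced complete bipartite (`IsCyc.adj_iff_odd`). -/

/-- `l` lists the vertices of a path of `G` from `a` to `b`, in order. -/
structure IsPathList {V : Type*} (G : SimpleGraph V) (l : List V) (a b : V) : Prop where
  nodup : l.Nodup
  chain : l.IsChain G.Adj
  head : l.head? = some a
  last : l.getLast? = some b

/-- `G` contains a cycle of length `m`, given by a list of vertices. -/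
def HasCyc {V : Type*} (G : SimpleGraph V) (m : ℕ) : Prop :=
  3 ≤ m ∧ ∃ l a b, IsPathList G l a b ∧ G.Adj b a ∧ l.length = m

/-! ### Paths as lists, cycles as periodic sequences -/

section PathLists

variable {V : Type*} {G : SimpleGraph V}

namespace IsPathList

theorem single (a : V) : IsPathList G [a] a a := ⟨by simp, by simp, by simp, by simp⟩

theorem ne_nil {l : List V} {a b : V} (h : IsPathList G l a b) : l ≠ [] := by
  rintro rfl; simpa using h.head

theorem length_pos {l : List V} {a b : V} (h : IsPathList G l a b) : 0 < l.length :=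
  List.length_pos_of_ne_nil h.ne_nil

theorem head_mem {l : List V} {a b : V} (h : IsPathList G l a b) : a ∈ l :=
  List.mem_of_mem_head? h.head

theorem last_mem {l : List V} {a b : V} (h : IsPathList G l a b) : b ∈ l :=
  List.mem_of_mem_getLast? h.last

theorem reverse {l : List V} {a b : V} (h : IsPathList G l a b) :
    IsPathList G l.reverse b a :=
  ⟨List.nodup_reverse.2 h.nodup,
    by rw [List.isChain_reverse]; exact h.chain.imp fun _ _ h => h.symm,
    by simp [h.last], by simp [h.head]⟩

theorem append {l₁ l₂ : List V} {a b c d : V} (h₁ : IsPathList G l₁ a b)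
    (h₂ : IsPathList G l₂ c d) (hbc : G.Adj b c) (hd : ∀ x ∈ l₁, x ∉ l₂) :
    IsPathList G (l₁ ++ l₂) a d := by
  refine ⟨List.nodup_append'.2 ⟨h₁.nodup, h₂.nodup, fun x hx hx' => hd x hx hx'⟩, ?_, ?_, ?_⟩
  · rw [List.isChain_append]
    refine ⟨h₁.chain, h₂.chain, ?_⟩
    intro x hx y hy
    rw [h₁.last] at hx; rw [h₂.head] at hy
    simp only [Option.mem_def, Option.some.injEq] at hx hy
    subst hx hy; exact hbc
  · simp [List.head?_append, h₁.head]
  · simp [List.getLast?_append, h₂.last]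

theorem concat {l : List V} {a b c : V} (h : IsPathList G l a b) (hbc : G.Adj b c) (hc : c ∉ l) :
    IsPathList G (l ++ [c]) a c :=
  h.append (single c) hbc (by rintro x hx hx'; simp at hx'; exact hc (hx' ▸ hx))

theorem cons {l : List V} {a b c : V} (h : IsPathList G l a b) (hca : G.Adj c a) (hc : c ∉ l) :
    IsPathList G (c :: l) c b :=
  (single c).append h hca (by simpa using hc)

theorem left {l₁ l₂ : List V} {z a b : V} (h : IsPathList G (l₁ ++ z :: l₂) a b) :
    IsPathList G (l₁ ++ [z]) a z := by
  have e : l₁ ++ z :: l₂ = (l₁ ++ [z]) ++ l₂ := by simp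
  refine ⟨?_, ?_, ?_, by simp⟩
  · have := h.nodup; rw [e] at this; exact this.of_append_left
  · have := h.chain; rw [e] at this; exact this.left_of_append
  · have := h.head; cases l₁ <;> simpa using this

theorem right {l₁ l₂ : List V} {z a b : V} (h : IsPathList G (l₁ ++ z :: l₂) a b) :
    IsPathList G (z :: l₂) z b := by
  refine ⟨h.nodup.of_append_right, h.chain.right_of_append, by simp, ?_⟩
  have := h.last
  rw [List.getLast?_append] at this
  rw [← this, List.getLast?_cons]; simp

theorem map {W : Type*} {H : SimpleGraph W} (f : V → W) (hf : Function.Injective f)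
    (hG : ∀ x y, G.Adj x y → H.Adj (f x) (f y)) {l : List V} {a b : V} (h : IsPathList G l a b) :
    IsPathList H (l.map f) (f a) (f b) :=
  ⟨h.nodup.map hf, List.isChain_map_of_isChain f (fun a b => hG a b) h.chain,
    by simp [h.head], by simp [h.last]⟩

theorem cyc {l : List V} {a b : V} (h : IsPathList G l a b) (hba : G.Adj b a)
    (hl : 3 ≤ l.length) : HasCyc G l.length := ⟨hl, l, a, b, h, hba, rfl⟩

/-- The vertices of a path list as a function of the index. -/
theorem getElem_adj {l : List V} {a b : V} (h : IsPathList G l a b) (i : ℕ)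
    (hi : i + 1 < l.length) : G.Adj l[i] l[i + 1] :=
  List.isChain_iff_getElem.1 h.chain i hi

theorem getElem_zero {l : List V} {a b : V} (h : IsPathList G l a b) :
    l[0]'h.length_pos = a := by
  have := h.head
  rw [List.head?_eq_getElem?, List.getElem?_eq_getElem h.length_pos] at this
  simpa using this

theorem getElem_last {l : List V} {a b : V} (h : IsPathList G l a b) :
    l[l.length - 1]'(Nat.sub_lt h.length_pos one_pos) = b := by
  have := h.last
  rw [List.getLast?_eq_getElem?, List.getElem?_eq_getElem (Nat.sub_lt h.length_pos one_pos)] at this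
  simpa using this

theorem exists_walk {l : List V} {a b : V} (h : IsPathList G l a b) :
    ∃ p : G.Walk a b, p.support = l := by
  induction l generalizing a with
  | nil => exact absurd rfl h.ne_nil
  | cons x l ih =>
    have hx : x = a := by simpa using h.head
    subst hx
    cases l with
    | nil =>
      have hb : x = b := by simpa using h.last
      subst hb
      exact ⟨.nil, by simp⟩
    | cons y l =>
      have h' : IsPathList G (y :: l) y b := (show IsPathList G ([x] ++ y :: l) x b from h).right
      obtain ⟨p, hp⟩ := ih h'
      have hxy : G.Adj x y := by have := h.chain; simp at this; exact this.1
      exact ⟨.cons hxy p, by simp [hp]⟩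

end IsPathList

theorem HasCyc.hasCycleOfLength {m : ℕ} (h : HasCyc G m) : HasCycleOfLength G m := by
  obtain ⟨hm, l, a, b, hl, hba, rfl⟩ := h
  obtain ⟨p, hp⟩ := hl.exists_walk
  have hpath : p.IsPath := by rw [Walk.isPath_def, hp]; exact hl.nodup
  have hlen : p.length + 1 = l.length := by rw [← hp, Walk.length_support]
  refine ⟨b, .cons hba p, ?_, by simp [hlen]⟩
  rw [Walk.cons_isCycle_iff]
  -- If the closing edge already lay on the path, the path would be that single edge, against length
  -- at least 3.
  refine ⟨hpath, fun he => ?_⟩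
  rw [Sym2.eq_swap] at he
  have := hpath.length_eq_one_of_mem_edges he
  omega

theorem HasCyc.map {W : Type*} {H : SimpleGraph W} (f : V → W) (hf : Function.Injective f)
    (hG : ∀ x y, G.Adj x y → H.Adj (f x) (f y)) {m : ℕ} (h : HasCyc G m) : HasCyc H m := by
  obtain ⟨hm, l, a, b, hl, hba, h⟩ := h
  exact ⟨hm, l.map f, f a, f b, hl.map f hf hG, hG _ _ hba, by simpa using h⟩

theorem HasCyc.le_card [Fintype V] {m : ℕ} (h : HasCyc G m) : m ≤ Fintype.card V := by
  obtain ⟨hm, l, a, b, hl, hba, rfl⟩ := h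
  exact hl.nodup.length_le_card

/-- The list `x i, x (i + 1), …, x (i + n - 1)`. -/
def arc (x : ℕ → V) (i n : ℕ) : List V := (List.range' i n).map x

@[simp] theorem length_arc (x : ℕ → V) (i n : ℕ) : (arc x i n).length = n := by simp [arc]

theorem mem_arc {x : ℕ → V} {i n : ℕ} {v : V} :
    v ∈ arc x i n ↔ ∃ t, i ≤ t ∧ t < i + n ∧ x t = v := by
  simp [arc, and_assoc]

theorem arc_isPathList {x : ℕ → V} {i n : ℕ}
    (hinj : ∀ s t, i ≤ s → s < i + n → i ≤ t → t < i + n → x s = x t → s = t)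
    (hadj : ∀ t, i ≤ t → t + 1 < i + n → G.Adj (x t) (x (t + 1))) (hn : 0 < n) :
    IsPathList G (arc x i n) (x i) (x (i + n - 1)) := by
  refine ⟨?_, ?_, ?_, ?_⟩
  · refine List.Nodup.map_on ?_ (List.nodup_range' (step := 1))
    intro s hs t ht h
    simp at hs ht
    exact hinj s t hs.1 hs.2 ht.1 ht.2 h
  · rw [List.isChain_iff_getElem]
    intro j hj
    simp only [arc, List.length_map, List.length_range'] at hj
    simp only [arc, List.getElem_map, List.getElem_range']
    have := hadj (i + j) (by omega) (by omega)
    simpa [add_assoc] using this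
  · simp [arc, List.head?_eq_getElem?, hn]
  · simp [arc, List.getLast?_eq_getElem?, hn]
    congr 1; omega

/-- `f` runs around a cycle of `G` of length `m`. -/
structure IsCyc (G : SimpleGraph V) (f : ℕ → V) (m : ℕ) : Prop where
  three_le : 3 ≤ m
  inj : ∀ i j, f i = f j → i % m = j % m
  periodic : ∀ i, f (i + m) = f i
  adj : ∀ i, G.Adj (f i) (f (i + 1))

/-- Indexing a cycle by all of ℕ makes rotations and arcs across the seam free of case distinctions;
reduction modulo `m` is needed only for counting. -/
theorem HasCyc.exists_isCyc {m : ℕ} (h : HasCyc G m) : ∃ f, IsCyc G f m := by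
  obtain ⟨hm, l, a, b, hl, hba, rfl⟩ := h
  have hpos := hl.length_pos
  refine ⟨fun i => l[i % l.length]'(Nat.mod_lt _ hpos), hm, ?_, ?_, ?_⟩
  · intro i j hij
    exact (hl.nodup.getElem_inj_iff).1 hij
  · intro i; simp
  · intro i
    have h1 := Nat.mod_lt i hpos
    by_cases h2 : i % l.length + 1 < l.length
    · have h3 : (i + 1) % l.length = i % l.length + 1 := by
        rw [Nat.add_mod, Nat.mod_eq_of_lt (show 1 < l.length by omega), Nat.mod_eq_of_lt h2]
      have := hl.getElem_adj _ h2
      simpa only [h3] using this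
    · have h4 : i % l.length = l.length - 1 := by omega
      have h3 : (i + 1) % l.length = 0 := by
        rw [Nat.add_mod, Nat.mod_eq_of_lt (show 1 < l.length by omega), h4,
          show l.length - 1 + 1 = l.length by omega, Nat.mod_self]
      simp only [h3, h4, hl.getElem_last, hl.getElem_zero]
      exact hba

namespace IsCyc

variable {f : ℕ → V} {m : ℕ}

theorem shift (h : IsCyc G f m) (s : ℕ) : IsCyc G (fun i => f (i + s)) m :=
  ⟨h.three_le, fun i j hij => Nat.ModEq.add_right_cancel' s (h.inj _ _ hij),
    fun i => by rw [show i + m + s = i + s + m by omega, h.periodic],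
    fun i => by rw [show i + 1 + s = i + s + 1 by omega]; exact h.adj _⟩

theorem inj_window (h : IsCyc G f m) {i s t : ℕ} (hs : i ≤ s) (hs' : s < i + m) (ht : i ≤ t)
    (ht' : t < i + m) (hst : f s = f t) : s = t := by
  have := h.inj _ _ hst
  rcases le_total s t with h1 | h1
  · have h2 := (Nat.modEq_iff_dvd' h1).1 this
    have := Nat.eq_zero_of_dvd_of_lt h2 (by omega); omega
  · have h2 := (Nat.modEq_iff_dvd' h1).1 this.symm
    have := Nat.eq_zero_of_dvd_of_lt h2 (by omega); omega

theorem arc_isPathList (h : IsCyc G f m) (i n : ℕ) (hn : 0 < n) (hnm : n ≤ m) :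
    IsPathList G (arc f i n) (f i) (f (i + n - 1)) :=
  _root_.arc_isPathList
    (fun _ _ hs hs' ht ht' => h.inj_window hs (by omega) ht (by omega)) (fun _ _ _ => h.adj _) hn

theorem periodic_mul (h : IsCyc G f m) (i j : ℕ) : f (i + m * j) = f i := by
  induction j with
  | zero => simp
  | succ j ih => rw [Nat.mul_succ, ← add_assoc, h.periodic, ih]

theorem apply_mod (h : IsCyc G f m) (i : ℕ) : f (i % m) = f i := by
  conv_rhs => rw [← Nat.mod_add_div i m]
  rw [h.periodic_mul]

theorem hasCyc (h : IsCyc G f m) : HasCyc G m := by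
  have := h.three_le
  have h1 := (h.arc_isPathList 0 m (by omega) le_rfl)
  have h2 : G.Adj (f (0 + m - 1)) (f 0) := by
    have := h.adj (m - 1)
    have h0 := h.periodic 0
    rw [Nat.zero_add] at h0
    rw [Nat.sub_add_cancel (by omega), h0] at this
    simpa using this
  have := h1.cyc h2 (by simpa using this)
  simpa using this

end IsCyc

/-- A path outside a cycle whose ends see the cycle at distance `d` closes up. -/
theorem IsCyc.hasCyc_of_path {f : ℕ → V} {m : ℕ} (h : IsCyc G f m) {Q : List V} {v w : V}
    (hQ : IsPathList G Q v w) (hd : ∀ i, f i ∉ Q) {i d : ℕ} (hdm : d < m) (hd1 : 1 ≤ d)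
    (hv : G.Adj v (f i)) (hw : G.Adj w (f (i + d))) : HasCyc G (d + 1 + Q.length) := by
  have h1 := h.arc_isPathList i (d + 1) (by omega) (by omega)
  have h2 := hQ.reverse.append h1 hv (by
    intro y hy hy'
    obtain ⟨t, _, _, rfl⟩ := mem_arc.1 hy'
    exact hd t (by simpa using hy))
  have h3 := h2.cyc (by simpa [← add_assoc] using hw.symm) (by
    have := hQ.length_pos
    simp; omega)
  simpa [add_comm, add_left_comm] using h3

end PathLists

/-! ### Longest cycles and vertices off them -/

section LongCycles

open scoped Classical

variable {V : Type*} {G : SimpleGraph V}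

/-- The number of neighbours of `v` in the finite set `S`. -/
noncomputable def inDeg (G : SimpleGraph V) (S : Finset V) (v : V) : ℕ :=
  (S.filter (G.Adj v)).card

/-- Twice the number of edges of `G` inside `S`. -/
noncomputable def degSum (G : SimpleGraph V) (S : Finset V) : ℕ := ∑ v ∈ S, inDeg G S v

theorem exists_greatest {P : ℕ → Prop} (h : ∃ s, P s) (B : ℕ) (hB : ∀ s, P s → s ≤ B) :
    ∃ s, P s ∧ ∀ t, P t → t ≤ s := by
  obtain ⟨s, hs⟩ := h
  exact ⟨Nat.findGreatest P B, Nat.findGreatest_spec (hB s hs) hs,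
    fun t ht => Nat.le_findGreatest (hB t ht) ht⟩

theorem add_mod_injOn (m d : ℕ) :
    Set.InjOn (fun i => (i + d) % m) (Finset.range m : Set ℕ) := by
  intro i hi j hj hij
  simp at hi hj
  have h : i % m = j % m := Nat.ModEq.add_right_cancel' d hij
  rwa [Nat.mod_eq_of_lt hi, Nat.mod_eq_of_lt hj] at h

theorem card_image_add_mod {m : ℕ} {A : Finset ℕ} (hA : A ⊆ Finset.range m) (d : ℕ) :
    (A.image (fun i => (i + d) % m)).card = A.card :=
  Finset.card_image_of_injOn ((add_mod_injOn m d).mono (by exact_mod_cast hA))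

theorem image_add_mod_subset {m : ℕ} (hm : 0 < m) (A : Finset ℕ) (d : ℕ) :
    A.image (fun i => (i + d) % m) ⊆ Finset.range m := by
  intro x hx
  obtain ⟨i, _, rfl⟩ := Finset.mem_image.1 hx
  exact Finset.mem_range.2 (Nat.mod_lt _ hm)

/-- Pigeonhole in the cyclic group of order `m`: the translate of `A` by `d` cannot miss `B`. This
turns degree sums into pairs of neighbours at a prescribed distance on a cycle. -/
theorem exists_add_mod_mem {m : ℕ} {A B : Finset ℕ} (hA : A ⊆ Finset.range m)
    (hB : B ⊆ Finset.range m) (h : m < A.card + B.card) (d : ℕ) :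
    ∃ i ∈ A, (i + d) % m ∈ B := by
  by_contra! hc
  have hm : 0 < m := by
    rcases Nat.eq_zero_or_pos m with rfl | h'
    · simp at hA hB; subst hA hB; simp at h
    · exact h'
  have hdisj : Disjoint (A.image (fun i => (i + d) % m)) B := by
    rw [Finset.disjoint_left]
    intro x hx
    obtain ⟨i, hi, rfl⟩ := Finset.mem_image.1 hx
    exact hc i hi
  have h1 := Finset.card_le_card (Finset.union_subset (image_add_mod_subset hm A d) hB)
  rw [Finset.card_union_of_disjoint hdisj, card_image_add_mod hA, Finset.card_range] at h1
  omega

/-- The positions of the neighbours of `v` on the closed sequence `f` of length `m`. -/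
noncomputable def posSet (G : SimpleGraph V) (f : ℕ → V) (m : ℕ) (v : V) : Finset ℕ :=
  (Finset.range m).filter (fun i => G.Adj v (f i))

theorem posSet_subset (f : ℕ → V) (m : ℕ) (v : V) : posSet G f m v ⊆ Finset.range m :=
  Finset.filter_subset _ _

namespace IsCyc

variable {f : ℕ → V} {m : ℕ}

theorem injOn (h : IsCyc G f m) : Set.InjOn f (Finset.range m : Set ℕ) := by
  intro i hi j hj hij
  simp at hi hj
  exact h.inj_window (i := 0) (by omega) (by omega) (by omega) (by omega) hij

theorem card_image (h : IsCyc G f m) : ((Finset.range m).image f).card = m := by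
  rw [Finset.card_image_of_injOn h.injOn, Finset.card_range]

theorem mem_posSet_mod (h : IsCyc G f m) {v : V} {i : ℕ} :
    i % m ∈ posSet G f m v ↔ G.Adj v (f i) := by
  have := h.three_le
  simp [posSet, h.apply_mod, Nat.mod_lt i (show 0 < m by omega)]

theorem card_posSet (h : IsCyc G f m) (v : V) :
    (posSet G f m v).card = inDeg G ((Finset.range m).image f) v := by
  rw [inDeg, Finset.filter_image, Finset.card_image_of_injOn]
  · rfl
  · exact h.injOn.mono (by intro x hx; simp at hx ⊢; exact hx.1)

theorem mem_image_iff (h : IsCyc G f m) {v : V} :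
    v ∈ (Finset.range m).image f ↔ ∃ i, f i = v := by
  have := h.three_le
  simp only [Finset.mem_image, Finset.mem_range]
  exact ⟨fun ⟨i, _, hi⟩ => ⟨i, hi⟩,
    fun ⟨i, hi⟩ => ⟨i % m, Nat.mod_lt _ (by omega), by rw [h.apply_mod, hi]⟩⟩

/-- A vertex off a cycle that sees more than half of it lies on cycles of all lengths. -/
theorem hasCyc_of_card_posSet (h : IsCyc G f m) {v : V} (hv : ∀ i, f i ≠ v)
    (hd : m < 2 * (posSet G f m v).card) {l : ℕ} (hl : 3 ≤ l) (hlm : l ≤ m + 1) : HasCyc G l := by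
  -- Two neighbours at distance `l - 2` bound an arc of `l - 1` vertices, which `v` closes to length
  -- `l`.
  obtain ⟨i, hi, hj⟩ := exists_add_mod_mem (posSet_subset (G := G) f m v)
    (posSet_subset (G := G) f m v) (by omega) (l - 2)
  have h1 : G.Adj v (f i) := (Finset.mem_filter.1 hi).2
  have h2 : G.Adj v (f (i + (l - 2))) := h.mem_posSet_mod.1 hj
  have := h.hasCyc_of_path (IsPathList.single v) (by simpa using hv) (i := i) (d := l - 2)
    (by omega) (by omega) h1 h2
  convert this using 1
  simp; omega

end IsCyc

theorem inDeg_mono {S T : Finset V} (h : S ⊆ T) (v : V) : inDeg G S v ≤ inDeg G T v :=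
  Finset.card_le_card (Finset.filter_subset_filter _ h)

theorem inDeg_union_of_disjoint {S T : Finset V} (h : Disjoint S T) (v : V) :
    inDeg G (S ∪ T) v = inDeg G S v + inDeg G T v := by
  rw [inDeg, Finset.filter_union, Finset.card_union_of_disjoint]
  · rfl
  · exact Finset.disjoint_filter_filter h

variable [Fintype V]

/-- If a longest cycle covers more than half of the vertices but not all of them, some vertex off
the cycle has degree less than half of the order of the graph. -/
theorem IsCyc.exists_small_degree {f : ℕ → V} {m : ℕ} (h : IsCyc G f m)
    (hmax : ∀ l, m < l → ¬ HasCyc G l) (hm : m < Fintype.card V) (hm2 : Fintype.card V < 2 * m) :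
    ∃ v, (∀ i, f i ≠ v) ∧ 2 * inDeg G Finset.univ v < Fintype.card V := by
  by_contra! hcon
  set C := (Finset.range m).image f with hC
  have hm3 := h.three_le
  have hCR : C ∪ Cᶜ = Finset.univ := by simp
  have hR : Cᶜ.card = Fintype.card V - m := by rw [Finset.card_compl, h.card_image]
  have hout : ∀ v, v ∈ Cᶜ ↔ ∀ i, f i ≠ v := by
    intro v; rw [Finset.mem_compl, hC, h.mem_image_iff]; push Not; rfl
  obtain ⟨y, hy⟩ : Cᶜ.Nonempty := by rw [← Finset.card_pos]; omega
  -- `Q` is a longest path off the cycle. By maximality the off-cycle neighbours of its ends lie on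
  -- `Q`, so each end has at most `s - 1` of them.
  obtain ⟨s, ⟨Q, v, w, hQ, hQR, hQs⟩, hsmax⟩ := exists_greatest
    (P := fun s => ∃ Q v w, IsPathList G Q v w ∧ (∀ z ∈ Q, z ∈ Cᶜ) ∧ Q.length = s)
    ⟨1, [y], y, y, IsPathList.single y, by simpa using hy, rfl⟩ (Fintype.card V)
    (by rintro s ⟨Q, v, w, hQ, _, rfl⟩; exact hQ.nodup.length_le_card)
  have hs1 : 1 ≤ s := hQs ▸ hQ.length_pos
  have hsr : s ≤ Fintype.card V - m := by
    rw [← hR, ← hQs, ← List.toFinset_card_of_nodup hQ.nodup]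
    exact Finset.card_le_card fun z hz => hQR z (by simpa using hz)
  have hbound : ∀ Q v w, IsPathList G Q v w → (∀ z ∈ Q, z ∈ Cᶜ) → Q.length = s →
      inDeg G Cᶜ v ≤ s - 1 := by
    intro Q v w hQ hQR hQs
    have : Cᶜ.filter (G.Adj v) ⊆ Q.toFinset.erase v := by
      intro z hz
      rw [Finset.mem_filter] at hz
      rw [Finset.mem_erase, List.mem_toFinset]
      refine ⟨hz.2.ne', ?_⟩
      by_contra hzQ
      have := hsmax (s + 1) ⟨z :: Q, z, w, hQ.cons hz.2.symm hzQ, by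
        simp only [List.mem_cons]; rintro a (rfl | ha)
        exacts [hz.1, hQR a ha], by simp [hQs]⟩
      omega
    have h1 := Finset.card_le_card this
    rw [Finset.card_erase_of_mem (by simpa using hQ.head_mem),
      List.toFinset_card_of_nodup hQ.nodup, hQs] at h1
    exact h1
  have hdv := hbound Q v w hQ hQR hQs
  have hdw := hbound Q.reverse w v hQ.reverse (by simpa using hQR) (by simpa using hQs)
  have hvout := (hout v).1 (hQR v hQ.head_mem)
  have hwout := (hout w).1 (hQR w hQ.last_mem)
  have hdeg : ∀ v, inDeg G Finset.univ v = (posSet G f m v).card + inDeg G Cᶜ v := by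
    intro v
    rw [h.card_posSet, ← hC, ← inDeg_union_of_disjoint disjoint_compl_right, hCR]
  have hIv := hcon v hvout
  have hIw := hcon w hwout
  rw [hdeg] at hIv hIw
  have hQC : ∀ i, f i ∉ Q := fun i hi => (hout _).1 (hQR _ hi) i rfl
  have hQC' : ∀ i, f i ∉ Q.reverse := fun i hi => hQC i (by simpa using hi)
  -- no neighbours of the two ends at consecutive places
  have hcons : ∀ x a b, (a = v ∨ a = w) → (b = v ∨ b = w) → G.Adj a (f x) →
      G.Adj b (f (x + 1)) → False := by
    intro x a b ha hb hax hbx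
    have hax' : G.Adj a (f (x + 1 + (m - 1))) := by
      rw [show x + 1 + (m - 1) = x + m by omega, h.periodic]; exact hax
    rcases ha with rfl | rfl <;> rcases hb with rfl | rfl
    · exact hmax _ (by simp; omega) (h.hasCyc_of_path (IsPathList.single _) (by simpa using hvout)
        (by omega : m - 1 < m) (by omega) hbx hax')
    · exact hmax _ (by simp; omega) (h.hasCyc_of_path hQ.reverse hQC'
        (by omega : m - 1 < m) (by omega) hbx hax')
    · exact hmax _ (by omega) (h.hasCyc_of_path hQ hQC
        (by omega : m - 1 < m) (by omega) hbx hax')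
    · exact hmax _ (by simp; omega) (h.hasCyc_of_path (IsPathList.single _) (by simpa using hwout)
        (by omega : m - 1 < m) (by omega) hbx hax')
  -- The least such `d` is the shortest way forward from a neighbour of `v` to a neighbour of `w`.
  -- The value `m` is allowed because the ends may share a single neighbour.
  have hex : ∃ d, 1 ≤ d ∧ d ≤ m ∧ ∃ i, G.Adj v (f i) ∧ G.Adj w (f (i + d)) := by
    obtain ⟨i, hi⟩ : (posSet G f m v).Nonempty := by rw [← Finset.card_pos]; omega
    obtain ⟨j, hj⟩ : (posSet G f m w).Nonempty := by rw [← Finset.card_pos]; omega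
    simp only [posSet, Finset.mem_filter, Finset.mem_range] at hi hj
    by_cases hij : i < j
    · exact ⟨j - i, by omega, by omega, i, hi.2, by
        rw [show i + (j - i) = j by omega]; exact hj.2⟩
    · exact ⟨j + m - i, by omega, by omega, i, hi.2, by
        rw [show i + (j + m - i) = j + m by omega, h.periodic]; exact hj.2⟩
  obtain ⟨hd1, hdm, i, hiv, hiw⟩ := Nat.find_spec hex
  set d := Nat.find hex with hd
  have hmin : ∀ e, 1 ≤ e → e < d → ∀ j, G.Adj v (f j) → ¬ G.Adj w (f (j + e)) := by
    intro e he hed j hj hj'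
    exact Nat.find_min hex hed ⟨he, by omega, j, hj, hj'⟩
  -- If `d ≤ s`, replacing the `d - 1` inner vertices of this arc by the `s` vertices of `Q` gives a
  -- longer cycle.
  have hsd : s < d := by
    by_contra hsd
    have : G.Adj v (f (i + d + (m - d))) := by
      rw [show i + d + (m - d) = i + m by omega, h.periodic]; exact hiv
    exact hmax _ (by simp; omega) (h.hasCyc_of_path hQ.reverse hQC'
        (by omega : m - d < m) (by omega) hiw this)
  have hgap : ∀ j, 1 ≤ j → j ≤ s → ¬ G.Adj v (f (i + j)) ∧ ¬ G.Adj w (f (i + j)) := by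
    intro j hj1 hjs
    refine ⟨fun hv' => hmin (d - j) (by omega) (by omega) _ hv' ?_,
      hmin j hj1 (by omega) i hiv⟩
    rw [show i + j + (d - j) = i + d by omega]; exact hiw
  -- The set `A`, its shift by one, and the positions `i + 2, …, i + s` in the gap are pairwise
  -- disjoint; `i + 1` is omitted because it lies in the shift. So 2|A| + s - 1 ≤ m, which
  -- contradicts 2|A| ≥ n - 2(s - 1) together with s ≤ n - m.
  set A := posSet G f m v ∪ posSet G f m w with hA
  have hAm : A ⊆ Finset.range m := Finset.union_subset (posSet_subset ..) (posSet_subset ..)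
  have hmemA : ∀ x, x % m ∈ A ↔ G.Adj v (f x) ∨ G.Adj w (f x) := by
    intro x; rw [hA, Finset.mem_union, h.mem_posSet_mod, h.mem_posSet_mod]
  have hmemA' : ∀ x ∈ A, G.Adj v (f x) ∨ G.Adj w (f x) := by
    intro x hx; rw [← hmemA, Nat.mod_eq_of_lt (Finset.mem_range.1 (hAm hx))]; exact hx
  set A1 := A.image (fun i => (i + 1) % m) with hA1
  set J := (Finset.Icc 2 s).image (fun j => (i + j) % m) with hJ
  have hJcard : J.card = s - 1 := by
    rw [hJ, Finset.card_image_of_injOn, Nat.card_Icc]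
    · omega
    · intro a ha b hb hab
      simp only [Finset.coe_Icc, Set.mem_Icc] at ha hb
      have : a % m = b % m := Nat.ModEq.add_left_cancel' i hab
      rwa [Nat.mod_eq_of_lt (by omega), Nat.mod_eq_of_lt (by omega)] at this
  have d1 : Disjoint A A1 := by
    rw [Finset.disjoint_right]
    intro x hx
    obtain ⟨y, hy, rfl⟩ := Finset.mem_image.1 hx
    rw [hmemA]
    rintro (h1 | h1) <;> rcases hmemA' y hy with h2 | h2
    · exact hcons y v v (.inl rfl) (.inl rfl) h2 h1
    · exact hcons y w v (.inr rfl) (.inl rfl) h2 h1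
    · exact hcons y v w (.inl rfl) (.inr rfl) h2 h1
    · exact hcons y w w (.inr rfl) (.inr rfl) h2 h1
  have d2 : Disjoint (A ∪ A1) J := by
    rw [Finset.disjoint_right]
    intro x hx hx'
    obtain ⟨j, hj, rfl⟩ := Finset.mem_image.1 hx
    rw [Finset.mem_Icc] at hj
    rcases Finset.mem_union.1 hx' with h1 | h1
    · rw [hmemA] at h1
      rcases h1 with h1 | h1
      exacts [(hgap j (by omega) hj.2).1 h1, (hgap j (by omega) hj.2).2 h1]
    · obtain ⟨y, hy, hyj⟩ := Finset.mem_image.1 h1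
      have h2 : f y = f (i + (j - 1)) := by
        rw [← h.apply_mod y, ← h.apply_mod (i + (j - 1))]
        congr 1
        refine Nat.ModEq.add_right_cancel' 1 ?_
        rw [show i + (j - 1) + 1 = i + j by omega]; exact hyj
      have h3 := hmemA' y hy
      rw [h2] at h3
      rcases h3 with h3 | h3
      exacts [(hgap (j - 1) (by omega) (by omega)).1 h3, (hgap (j - 1) (by omega) (by omega)).2 h3]
  have hsub : A ∪ A1 ∪ J ⊆ Finset.range m := by
    refine Finset.union_subset (Finset.union_subset hAm (image_add_mod_subset (by omega) _ _)) ?_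
    intro x hx
    obtain ⟨j, hj, rfl⟩ := Finset.mem_image.1 hx
    exact Finset.mem_range.2 (Nat.mod_lt _ (by omega))
  have hcard := Finset.card_le_card hsub
  rw [Finset.card_union_of_disjoint d2, Finset.card_union_of_disjoint d1, hA1,
    card_image_add_mod hAm, hJcard, Finset.card_range] at hcard
  have e1 : (posSet G f m v).card ≤ A.card := Finset.card_le_card Finset.subset_union_left
  have e2 : (posSet G f m w).card ≤ A.card := Finset.card_le_card Finset.subset_union_right
  omega

end LongCycles

/-! ### Dense graphs: cycles of all shorter lengths -/

section Pancyclic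

open scoped Classical

universe u

/-- The subgraph induced on the finite set `S`. -/
def subGraph {V : Type u} (G : SimpleGraph V) (S : Finset V) : SimpleGraph {x // x ∈ S} :=
  G.comap Subtype.val

variable {V : Type u} {G : SimpleGraph V}

theorem subGraph_adj {S : Finset V} {x y : {x // x ∈ S}} :
    (subGraph G S).Adj x y ↔ G.Adj x y := Iff.rfl

theorem inDeg_subGraph (S : Finset V) (x : {x // x ∈ S}) :
    inDeg (subGraph G S) Finset.univ x = inDeg G S x := by
  rw [inDeg, inDeg, ← Finset.card_map (Function.Embedding.subtype _)]
  congr 1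
  ext y
  simp [subGraph_adj, and_comm]

theorem degSum_subGraph (S : Finset V) : degSum (subGraph G S) Finset.univ = degSum G S := by
  rw [degSum, degSum, ← Finset.sum_coe_sort S]
  exact Finset.sum_congr rfl fun x _ => inDeg_subGraph S x

theorem HasCyc.of_subGraph {S : Finset V} {m : ℕ} (h : HasCyc (subGraph G S) m) : HasCyc G m :=
  h.map Subtype.val Subtype.val_injective fun _ _ h => h

theorem inDeg_erase_self (S : Finset V) (v : V) : inDeg G (S.erase v) v = inDeg G S v := by
  rw [inDeg, inDeg]
  congr 1
  ext x
  simp only [Finset.mem_filter, Finset.mem_erase]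
  exact ⟨fun h => ⟨h.1.2, h.2⟩, fun h => ⟨⟨h.2.ne', h.1⟩, h.2⟩⟩

theorem inDeg_erase {S : Finset V} {v : V} (hv : v ∈ S) (x : V) :
    inDeg G S x = inDeg G (S.erase v) x + if G.Adj v x then 1 else 0 := by
  conv_lhs => rw [← Finset.insert_erase hv]
  rw [inDeg, inDeg, Finset.filter_insert]
  by_cases h : G.Adj x v
  · rw [if_pos h, if_pos h.symm, Finset.card_insert_of_notMem (by simp)]
  · rw [if_neg h, if_neg (fun h' => h h'.symm), add_zero]

theorem degSum_erase {S : Finset V} {v : V} (hv : v ∈ S) :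
    degSum G S = degSum G (S.erase v) + 2 * inDeg G S v := by
  rw [degSum, ← Finset.add_sum_erase S _ hv, degSum]
  simp_rw [inDeg_erase hv]
  rw [Finset.sum_add_distrib, Finset.sum_boole, if_neg (G.loopless.irrefl v), Nat.cast_id]
  have : ((S.erase v).filter (G.Adj v)).card = inDeg G (S.erase v) v := rfl
  rw [this]
  ring

theorem IsCyc.subGraph {f : ℕ → V} {m : ℕ} (h : IsCyc G f m) {S : Finset V}
    (hS : ∀ i, f i ∈ S) : IsCyc (subGraph G S) (fun i => ⟨f i, hS i⟩) m :=
  ⟨h.three_le, fun i j hij => h.inj i j (by simpa using hij),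
    fun i => by simp [h.periodic], fun i => h.adj i⟩

theorem inDeg_le_card (S : Finset V) (v : V) : inDeg G S v ≤ S.card :=
  Finset.card_le_card (Finset.filter_subset _ _)

/-- The neighbours of two consecutive vertices `g (n - 1)`, `g 0` of a Hamiltonian cycle obey a
shifted exclusion rule if there is no cycle of length `l`. -/
theorem IsCyc.not_adj_shift {g : ℕ → V} {n : ℕ} (h : IsCyc G g n) {l : ℕ} (hl : 3 ≤ l)
    (hln : l < n) (hno : ¬ HasCyc G l) {j : ℕ} (hj : j < n - 2) (h0 : G.Adj (g 0) (g (j + 1))) :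
    ¬ G.Adj (g (n - 1)) (g ((j + (l - 3)) % (n - 2) + 1)) := by
  intro h1
  apply hno
  have hlast : G.Adj (g (n - 1)) (g 0) := by
    have := h.adj (n - 1)
    rw [Nat.sub_add_cancel (by omega)] at this
    have h0 := h.periodic 0
    rw [Nat.zero_add] at h0
    rwa [h0] at this
  -- The `n - 2` inner vertices are read cyclically. Without wrap-around the cycle is `g 0`, the arc
  -- of `l - 2` vertices from `g (j + 1)`, and `g (n - 1)`. With wrap-around it ascends from `g 0`
  -- to the neighbour of `g (n - 1)`, jumps to `g (n - 1)` and descends to `g (j + 1)`.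
  by_cases hd : j + (l - 3) < n - 2
  · rw [Nat.mod_eq_of_lt hd] at h1
    have hp := h.arc_isPathList (j + 1) (l - 2) (by omega) (by omega)
    rw [show j + 1 + (l - 2) - 1 = j + (l - 3) + 1 by omega] at hp
    have hp1 := hp.cons h0 (by
      rw [mem_arc]; rintro ⟨t, ht1, ht2, ht3⟩
      have := h.inj_window (i := 0) (by omega) (by omega) (by omega) (by omega) ht3
      omega)
    have hp2 := hp1.concat h1.symm (by
      rw [List.mem_cons, mem_arc]; rintro (ht3 | ⟨t, ht1, ht2, ht3⟩)
      · exact hlast.ne ht3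
      · have := h.inj_window (i := 0) (by omega) (by omega) (by omega) (by omega) ht3
        omega)
    have := hp2.cyc hlast (by simp; omega)
    convert this using 1
    simp; omega
  · have hmod : (j + (l - 3)) % (n - 2) = j + (l - 3) - (n - 2) := by
      rw [Nat.mod_eq_sub_mod (by omega), Nat.mod_eq_of_lt (by omega)]
    rw [hmod] at h1
    have hp := h.arc_isPathList 0 (j + (l - 3) - (n - 2) + 2) (by omega) (by omega)
    have hq := (h.arc_isPathList (j + 1) (n - 1 - j) (by omega) (by omega)).reverse
    rw [show j + 1 + (n - 1 - j) - 1 = n - 1 by omega] at hq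
    rw [show 0 + (j + (l - 3) - (n - 2) + 2) - 1 = j + (l - 3) - (n - 2) + 1 by omega] at hp
    have hp2 := hp.append hq h1.symm (by
      intro x hx hx'
      rw [List.mem_reverse, mem_arc] at hx'
      rw [mem_arc] at hx
      obtain ⟨t, ht1, ht2, rfl⟩ := hx
      obtain ⟨t', ht1', ht2', ht3⟩ := hx'
      have := h.inj_window (i := 0) (by omega) (by omega) (by omega) (by omega) ht3
      omega)
    have := hp2.cyc h0.symm (by simp; omega)
    convert this using 1
    simp; omega

/-- The neighbours of an endpoint of the edge `g (n - 1) g 0` among the other vertices. -/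
noncomputable def innerSet (G : SimpleGraph V) (g : ℕ → V) (n : ℕ) (v : V) : Finset ℕ :=
  (Finset.range (n - 2)).filter (fun j => G.Adj v (g (j + 1)))

variable [Fintype V]

theorem IsCyc.surj {g : ℕ → V} {n : ℕ} (h : IsCyc G g n) (hn : Fintype.card V = n) (v : V) :
    ∃ i < n, g i = v := by
  have : (Finset.range n).image g = Finset.univ := by
    rw [← Finset.card_eq_iff_eq_univ, h.card_image, hn]
  have hv := Finset.mem_univ v
  rw [← this, Finset.mem_image] at hv
  obtain ⟨i, hi, hiv⟩ := hv
  exact ⟨i, Finset.mem_range.1 hi, hiv⟩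

/-- The only possible neighbour that the inner positions miss is the other end of the edge, hence
the `+ 1`. -/
theorem IsCyc.inDeg_le_inner {g : ℕ → V} {n : ℕ} (h : IsCyc G g n) (hn : Fintype.card V = n)
    {v : V} (hv : v = g 0 ∨ v = g (n - 1)) :
    inDeg G Finset.univ v ≤ (innerSet G g n v).card + 1 := by
  have h3 := h.three_le
  obtain ⟨w, hw⟩ : ∃ w, ∀ j, j = 0 ∨ j = n - 1 → g j = v ∨ g j = w := by
    rcases hv with rfl | rfl
    · exact ⟨g (n - 1), by rintro j (rfl | rfl) <;> simp⟩
    · exact ⟨g 0, by rintro j (rfl | rfl) <;> simp⟩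
  have hsub : Finset.univ.filter (G.Adj v) ⊆
      insert w ((innerSet G g n v).image (fun j => g (j + 1))) := by
    intro z hz
    rw [Finset.mem_filter] at hz
    obtain ⟨i, hi, rfl⟩ := h.surj hn z
    rw [Finset.mem_insert, Finset.mem_image]
    by_cases hi0 : i = 0 ∨ i = n - 1
    · rcases hw i hi0 with h1 | h1
      · exact absurd h1 hz.2.ne'
      · exact .inl h1
    · refine .inr ⟨i - 1, ?_, by rw [Nat.sub_add_cancel (by omega)]⟩
      rw [innerSet, Finset.mem_filter, Finset.mem_range, Nat.sub_add_cancel (by omega)]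
      exact ⟨by omega, hz.2⟩
  calc inDeg G Finset.univ v ≤ _ := Finset.card_le_card hsub
    _ ≤ _ := Finset.card_insert_le _ _
    _ ≤ _ := by gcongr; exact Finset.card_image_le

theorem IsCyc.sum_inDeg {g : ℕ → V} {n : ℕ} (h : IsCyc G g n) (hn : Fintype.card V = n) :
    ∑ i ∈ Finset.range n, inDeg G Finset.univ (g i) = degSum G Finset.univ := by
  have : (Finset.range n).image g = Finset.univ := by
    rw [← Finset.card_eq_iff_eq_univ, h.card_image, hn]
  rw [degSum, ← this, Finset.sum_image h.injOn]

/-- Bondy: a Hamiltonian graph with more than `n² / 4` edges is pancyclic. -/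
theorem IsCyc.pancyclic {f : ℕ → V} {n : ℕ} (h : IsCyc G f n) (hn : Fintype.card V = n)
    (hD : n * n < 2 * degSum G Finset.univ) {l : ℕ} (hl : 3 ≤ l) (hln : l ≤ n) : HasCyc G l := by
  rcases hln.eq_or_lt with rfl | hln
  · exact h.hasCyc
  by_contra hno
  -- Averaging over the edges of the cycle: these degree sums add up to twice `degSum`, which
  -- exceeds n². The inner sets of the chosen edge then have total size at least `n - 1`, more than
  -- the `n - 2` positions.
  obtain ⟨i, hi⟩ : ∃ i, n + 1 ≤ inDeg G Finset.univ (f i) + inDeg G Finset.univ (f (i + 1)) := by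
    by_contra! hc
    have h1 := h.sum_inDeg hn
    have h2 := (h.shift 1).sum_inDeg hn
    have h3 : ∑ i ∈ Finset.range n, (inDeg G Finset.univ (f i) + inDeg G Finset.univ (f (i + 1)))
        ≤ ∑ i ∈ Finset.range n, n := Finset.sum_le_sum fun i _ => by have := hc i; omega
    rw [Finset.sum_add_distrib, h1, h2] at h3
    simp at h3
    omega
  have hg := h.shift (i + 1)
  set g : ℕ → V := fun j => f (j + (i + 1)) with hgdef
  have g0 : g 0 = f (i + 1) := by simp [hgdef]
  have g1 : g (n - 1) = f i := by
    rw [← h.periodic i]; simp only [hgdef]; congr 1; omega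
  have e0 := hg.inDeg_le_inner hn (.inl rfl)
  have e1 := hg.inDeg_le_inner hn (.inr rfl)
  rw [g0] at e0
  rw [g1] at e1
  obtain ⟨j, hj, hj'⟩ := exists_add_mod_mem (m := n - 2) (A := innerSet G g n (f (i + 1)))
    (B := innerSet G g n (f i)) (Finset.filter_subset _ _) (Finset.filter_subset _ _)
    (by omega) (l - 3)
  rw [innerSet, Finset.mem_filter, Finset.mem_range] at hj hj'
  refine hg.not_adj_shift hl hln hno hj.1 ?_ ?_
  · rw [g0]; exact hj.2
  · rw [g1]; exact hj'.2

/-- As long as a longest cycle is not Hamiltonian, a vertex of degree below half the order lies off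
it. Deleting that vertex keeps the cycle and keeps the number of edges above a quarter of the
squared order, so the argument descends to Bondy's theorem. -/
theorem hasCyc_of_dense {V : Type u} [Fintype V] {G : SimpleGraph V}
    (hD : Fintype.card V * Fintype.card V < 2 * degSum G Finset.univ) {m : ℕ} (hm : HasCyc G m)
    (hcm : Fintype.card V < 2 * m) {l : ℕ} (hl : 3 ≤ l) (hlm : l ≤ m) : HasCyc G l := by
  induction hn : Fintype.card V generalizing V m with
  | zero => have := hm.le_card; omega
  | succ n ih =>
    obtain ⟨s, hs, hsmax⟩ := exists_greatest ⟨m, hm⟩ _ fun s h => h.le_card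
    have hms := hsmax m hm
    obtain ⟨f, hf⟩ := hs.exists_isCyc
    have hsn := hs.le_card
    rcases hsn.eq_or_lt with hsn | hsn
    · exact hf.pancyclic hsn.symm (by rw [hsn]; exact hD) hl (by omega)
    · obtain ⟨v, hv, hdv⟩ := hf.exists_small_degree (fun l hl h => by have := hsmax l h; omega) hsn
        (by omega)
      have hcard := (Fintype.card_coe (Finset.univ.erase v)).trans
        (show (Finset.univ.erase v).card = n by
          rw [Finset.card_erase_of_mem (Finset.mem_univ v), Finset.card_univ, hn]; rfl)
      have hsub := hf.subGraph (S := Finset.univ.erase v) (by simpa using hv)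
      have hde := degSum_erase (G := G) (Finset.mem_univ v)
      refine (ih (V := {x // x ∈ Finset.univ.erase v}) (G := subGraph G _) ?_ hsub.hasCyc ?_ ?_
        hcard).of_subGraph
      · rw [hcard, degSum_subGraph]
        rw [hn] at hD hdv
        nlinarith
      · omega
      · omega

/-- A Hamiltonian graph on `n` vertices with minimum degree at least `n / 2` and without a cycle of
length `n - 1`: along the Hamiltonian cycle, vertices are adjacent exactly when their positions
have different parities. -/
theorem IsCyc.adj_iff_odd {f : ℕ → V} {n : ℕ} (h : IsCyc G f n) (hn : Fintype.card V = n)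
    (heven : Even n) (h4 : 4 ≤ n) (hdeg : ∀ v, n ≤ 2 * inDeg G Finset.univ v) (hno : ¬ HasCyc G (n - 1))
    {o : ℕ} (ho1 : 1 ≤ o) (hon : o < n) (p : ℕ) : G.Adj (f p) (f (p + o)) ↔ Odd o := by
  -- For `l = n - 1` there is no slack: the inner sets have total size at least `n - 2`, so the
  -- shifted exclusion rule becomes an equivalence. Its shift `l - 3 = n - 4` is -2 modulo `n - 2`.
  have key : ∀ p j, j < n - 2 → (G.Adj (f (p + 1)) (f (p + 1 + (j + 1))) ↔
      ¬ G.Adj (f p) (f (p + 1 + ((j + (n - 4)) % (n - 2) + 1)))) := by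
    intro i j hj
    have hg := h.shift (i + 1)
    set g : ℕ → V := fun j => f (j + (i + 1)) with hgdef
    have g0 : g 0 = f (i + 1) := by simp [hgdef]
    have g1 : g (n - 1) = f i := by
      rw [← h.periodic i]; simp only [hgdef]; congr 1; omega
    have gj : ∀ j, f (i + 1 + (j + 1)) = g (j + 1) := by
      intro j; simp only [hgdef]; congr 1; omega
    have e0 := hg.inDeg_le_inner hn (.inl rfl)
    have e1 := hg.inDeg_le_inner hn (.inr rfl)
    have d0 := hdeg (g 0)
    have d1 := hdeg (g (n - 1))
    rw [gj, gj, ← g0, ← g1]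
    constructor
    · intro ha
      have := hg.not_adj_shift (l := n - 1) (by omega) (by omega) hno hj ha
      rwa [show n - 1 - 3 = n - 4 by omega] at this
    · intro ha
      by_contra hb
      have hA : innerSet G g n (g 0) ⊆ Finset.range (n - 2) := Finset.filter_subset _ _
      have hB : innerSet G g n (g (n - 1)) ⊆ Finset.range (n - 2) := Finset.filter_subset _ _
      have hj1 : j ∉ innerSet G g n (g 0) := by
        intro hj'; rw [innerSet, Finset.mem_filter] at hj'; exact hb hj'.2
      have hA' : insert j (innerSet G g n (g 0)) ⊆ Finset.range (n - 2) :=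
        Finset.insert_subset (Finset.mem_range.2 hj) hA
      obtain ⟨t, ht, ht'⟩ := exists_add_mod_mem hA' hB (by
        rw [Finset.card_insert_of_notMem hj1]; omega) (n - 4)
      rw [Finset.mem_insert] at ht
      rw [innerSet, Finset.mem_filter] at ht'
      rcases ht with rfl | ht
      · exact ha ht'.2
      · rw [innerSet, Finset.mem_filter, Finset.mem_range] at ht
        have := hg.not_adj_shift (l := n - 1) (by omega) (by omega) hno ht.1 ht.2
        rw [show n - 1 - 3 = n - 4 by omega] at this
        exact this ht'.2
  have hlast : ∀ p, G.Adj (f p) (f (p + (n - 1))) := by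
    intro p
    have := h.adj (p + (n - 1))
    rw [show p + (n - 1) + 1 = p + n by omega, h.periodic] at this
    exact this.symm
  have hstep : ∀ p o, 2 ≤ o → o ≤ n - 3 → (G.Adj (f (p + 1)) (f (p + 1 + (o + 1))) ↔
      ¬ G.Adj (f p) (f (p + o))) := by
    intro p o h1 h2
    rw [key p o (by omega), show o + (n - 4) = (o - 2) + (n - 2) by omega, Nat.add_mod_right,
      Nat.mod_eq_of_lt (by omega), show p + 1 + (o - 2 + 1) = p + o by omega]
  -- At offset 2 the rule wraps around, and its counterpart is the cycle edge from `f p` to `f (p +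
  -- (n - 1))`, which is always present.
  have htwo : ∀ p, ¬ G.Adj (f (p + 1)) (f (p + 1 + 2)) := by
    intro p
    rw [show 2 = 1 + 1 from rfl, key p 1 (by omega), show 1 + (n - 4) = n - 3 by omega,
      Nat.mod_eq_of_lt (by omega), show p + 1 + (n - 3 + 1) = p + (n - 1) by omega, not_not]
    exact hlast p
  have hall : ∀ o, 2 ≤ o → o ≤ n - 2 → ∀ p, (G.Adj (f (p + 1)) (f (p + 1 + o)) ↔ Odd o) := by
    intro o ho
    induction o, ho using Nat.le_induction with
    | base => intro _ p; exact iff_of_false (htwo p) (by decide)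
    | succ o ho ih =>
      intro hon p
      rw [hstep p o ho (by omega), Nat.odd_add_one, not_iff_not, ← ih (by omega) (p + n - 1),
        show p + n - 1 + 1 = p + n by omega, h.periodic, show p + n + o = p + o + n by omega,
        h.periodic]
  -- Adding a full period gives position `p` a predecessor, as the form of `hall` requires.
  have : (G.Adj (f (p + n)) (f (p + n + o)) ↔ Odd o) := by
    rcases ho1.eq_or_lt with rfl | ho2
    · exact iff_of_true (h.adj _) (by decide)
    rcases (show o ≤ n - 2 ∨ o = n - 1 by omega) with h2 | rfl
    · have := hall o ho2 h2 (p + n - 1)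
      rwa [show p + n - 1 + 1 = p + n by omega] at this
    · exact iff_of_true (hlast _) (Nat.Even.sub_odd (by omega) heven odd_one)
  rwa [h.periodic, show p + n + o = p + o + n by omega, h.periodic] at this

end Pancyclic

/-! ### Two disjoint paths along a sequence in a graph without cut vertices -/

section Linkage

universe u

variable {V : Type u} {G : SimpleGraph V}

/-- `G` has no cut vertex and is connected: an edge leaves every proper part of `G - w`. -/
def NoCutVertex (G : SimpleGraph V) : Prop :=
  ∀ (w : V) (S : Set V), w ∉ S → S.Nonempty → (∃ y, y ≠ w ∧ y ∉ S) →
    ∃ a ∈ S, ∃ b, b ∉ S ∧ b ≠ w ∧ G.Adj a b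

theorem NoCutVertex.mono {G' : SimpleGraph V} (h : NoCutVertex G) (hG : G ≤ G') :
    NoCutVertex G' := by
  intro w S hw hS hy
  obtain ⟨a, ha, b, hb, hbw, hab⟩ := h w S hw hS hy
  exact ⟨a, ha, b, hb, hbw, hG hab⟩

theorem exists_first_mem {P : V → Prop} {l : List V} (h : ∃ a ∈ l, P a) :
    ∃ l₁ a l₂, l = l₁ ++ a :: l₂ ∧ P a ∧ ∀ b ∈ l₁, ¬ P b := by
  induction l with
  | nil => simp at h
  | cons c l ih =>
    by_cases hc : P c
    · exact ⟨[], c, l, rfl, hc, by simp⟩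
    · obtain ⟨l₁, a, l₂, rfl, ha, hl⟩ := ih (by
        obtain ⟨a, ha, hP⟩ := h
        rcases List.mem_cons.1 ha with rfl | ha
        exacts [absurd hP hc, ⟨a, ha, hP⟩])
      refine ⟨c :: l₁, a, l₂, rfl, ha, ?_⟩
      intro b hb
      rcases List.mem_cons.1 hb with rfl | hb
      exacts [hc, hl b hb]

theorem exists_last_mem {P : V → Prop} {l : List V} (h : ∃ a ∈ l, P a) :
    ∃ l₁ a l₂, l = l₁ ++ a :: l₂ ∧ P a ∧ ∀ b ∈ l₂, ¬ P b := by
  obtain ⟨l₁, a, l₂, h1, ha, h2⟩ := exists_first_mem (P := P) (l := l.reverse) (by simpa using h)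
  refine ⟨l₂.reverse, a, l₁.reverse, ?_, ha, by simpa using h2⟩
  rw [← List.reverse_reverse l, h1]; simp

/-- In a graph without cut vertices, two sets are joined by a path that avoids a given vertex and
has no inner vertex in either set. -/
theorem NoCutVertex.exists_path (hG : NoCutVertex G) {X Y : Set V} {w : V} (hX : X.Nonempty)
    (hY : Y.Nonempty) (hwX : w ∉ X) (hwY : w ∉ Y) :
    ∃ R z x, IsPathList G R z x ∧ z ∈ Y ∧ x ∈ X ∧ w ∉ R ∧
      (∀ r ∈ R, r ∈ Y → r = z) ∧ (∀ r ∈ R, r ∈ X → r = x) := by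
  -- Otherwise consider the vertices reachable from `y` or any other vertex of `Y` while avoiding
  -- `w`. They miss `X`, so an edge of `G - w` leaves them, yet its far end is reachable as well.
  have hreach : ∃ L z x, IsPathList G L z x ∧ z ∈ Y ∧ x ∈ X ∧ w ∉ L := by
    by_contra! hcon
    obtain ⟨y, hy⟩ := hY
    obtain ⟨x, hx⟩ := hX
    obtain ⟨a, ⟨L, z, hL, hz, hwL⟩, b, hb, hbw, hab⟩ :=
      hG w {v | ∃ L z, IsPathList G L z v ∧ z ∈ Y ∧ w ∉ L}
        (by rintro ⟨L, z, hL, -, hw⟩; exact hw hL.last_mem)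
        ⟨y, [y], y, IsPathList.single y, hy, by simp; rintro rfl; exact hwY hy⟩
        ⟨x, by rintro rfl; exact hwX hx, by
          rintro ⟨L, z, hL, hz, hw⟩; exact hw (hcon L z x hL hz hx)⟩
    by_cases hbL : b ∈ L
    · obtain ⟨L₁, L₂, rfl⟩ := List.append_of_mem hbL
      exact hb ⟨_, z, hL.left, hz, by simp at hwL ⊢; exact ⟨hwL.1, hwL.2.1⟩⟩
    · exact hb ⟨_, z, hL.concat hab hbL, hz, by simp [hwL, hbw.symm]⟩
  obtain ⟨L, z, x, hL, hz, hx, hw⟩ := hreach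
  -- Cutting at the first vertex in `X` and then at the last preceding vertex in `Y` removes all
  -- inner contacts.
  obtain ⟨L₁, x', L₂, rfl, hx', hL₁⟩ := exists_first_mem (P := (· ∈ X)) ⟨x, hL.last_mem, hx⟩
  obtain ⟨L₃, z', L₄, h34, hz', hL₄⟩ := exists_last_mem (P := (· ∈ Y)) ⟨z, hL.left.head_mem, hz⟩
  have hp := hL.left
  rw [h34] at hp
  have hsub : ∀ r ∈ z' :: L₄, r ∈ L₁ ++ [x'] := by
    intro r hr; rw [h34]; exact List.mem_append_right _ hr
  refine ⟨z' :: L₄, z', x', hp.right, hz', hx', ?_, ?_, ?_⟩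
  · intro hw'
    have := hsub w hw'
    simp only [List.mem_append, List.mem_cons, List.not_mem_nil, or_false] at this hw
    tauto
  · intro r hr hrY
    rcases List.mem_cons.1 hr with h | h
    exacts [h, absurd hrY (hL₄ r h)]
  · intro r hr hrX
    have := hsub r hr
    simp only [List.mem_append, List.mem_cons, List.not_mem_nil, or_false] at this
    rcases this with h | h
    exacts [absurd hrX (hL₁ r h), h]

/-- Two disjoint paths that start at `x p` and at some `x a` with `a < p`, end at `x q` and at some
`x j` with `q < j`, and meet the rest of the sequence `x` only between the positions `p` and `q`. -/
structure Linked (G : SimpleGraph V) (x : ℕ → V) (m p q a j : ℕ) (M N : List V) (h h' : V) :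
    Prop where
  fst : IsPathList G M h (x q)
  snd : IsPathList G N h' (x j)
  disj : ∀ v ∈ M, v ∉ N
  heads : (h = x a ∧ h' = x p) ∨ (h = x p ∧ h' = x a)
  ha : a < p
  hq : q < j
  hj : j < m
  avoid : ∀ t < m, (x t ∈ M ∨ x t ∈ N) → t = a ∨ t = j ∨ (p ≤ t ∧ t ≤ q)

theorem NoCutVertex.exists_linked (hG : NoCutVertex G) {x : ℕ → V} {m : ℕ}
    (hinj : ∀ s t, s < m → t < m → x s = x t → s = t)
    (hadj : ∀ t, t + 1 < m → G.Adj (x t) (x (t + 1))) {p q : ℕ} (hp : 0 < p) (hpq : p ≤ q)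
    (hqm : q + 1 < m) : ∃ a j M N h h', Linked G x m p q a j M N h h' := by
  -- The end position `q` advances one vertex at a time, and the two paths are repaired whenever the
  -- second already ends at the new position.
  induction q, hpq using Nat.le_induction with
  | base =>
    obtain ⟨R, z, y, hR, ⟨a, ha, hza⟩, ⟨j, hj, hjm, hyj⟩, hw, hRY, hRX⟩ :=
      hG.exists_path (X := {v | ∃ t, p < t ∧ t < m ∧ v = x t}) (Y := {v | ∃ t, t < p ∧ v = x t})
        (w := x p) ⟨_, p + 1, by omega, hqm, rfl⟩ ⟨_, 0, hp, rfl⟩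
        (by rintro ⟨t, h1, h2, h3⟩; have := hinj p t (by omega) h2 h3; omega)
        (by rintro ⟨t, h1, h3⟩; have := hinj p t (by omega) (by omega) h3; omega)
    refine ⟨a, j, [x p], R, _, _, IsPathList.single _, hyj ▸ hR, by simpa using hw,
      .inr ⟨rfl, hza⟩, ha, hj, hjm, ?_⟩
    intro t ht hmem
    rcases hmem with hmem | hmem
    · have := hinj t p ht (by omega) (by simpa using hmem); omega
    · rcases lt_trichotomy t p with h | h | h
      · have := hRY _ hmem ⟨t, h, rfl⟩
        have := hinj t a ht (by omega) (this.trans hza); omega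
      · omega
      · have := hRX _ hmem ⟨t, h, ht, rfl⟩
        have := hinj t j ht (by omega) (this.trans hyj); omega
  | succ q hpq ih =>
    obtain ⟨a, j, M, N, h, h', L⟩ := ih (by omega)
    have hLa := L.ha
    have hLq := L.hq
    have hLj := L.hj
    by_cases hjq : q + 1 < j
    · have h1 : x (q + 1) ∉ M ∧ x (q + 1) ∉ N := by
        rw [← not_or]; intro hc
        have := L.avoid (q + 1) (by omega) hc; omega
      refine ⟨a, j, M ++ [x (q + 1)], N, h, h', L.fst.concat (hadj q (by omega)) h1.1, L.snd, ?_,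
        L.heads, L.ha, hjq, L.hj, ?_⟩
      · intro v hv
        rcases List.mem_append.1 hv with hv | hv
        · exact L.disj v hv
        · rw [List.mem_singleton.1 hv]; exact h1.2
      · intro t ht hmem
        rw [List.mem_append, List.mem_singleton, or_assoc] at hmem
        rcases hmem with hmem | hmem | hmem
        · have := L.avoid t ht (.inl hmem); omega
        · have := hinj t (q + 1) ht (by omega) hmem; omega
        · have := L.avoid t ht (.inr hmem); omega
    · have hjq : j = q + 1 := by omega
      subst hjq
      have hwM : x (q + 1) ∉ M := fun hc => L.disj _ hc L.snd.last_mem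
      -- `N` already occupies `x (q + 1)` and can serve as the first path, so a new path to a later
      -- position is needed. `R` leads there from the part used so far while avoiding `x (q + 1)`;
      -- its attachment point `z` lies on `M`, on `N`, or before position `p`.
      obtain ⟨R, z, y, hR, ⟨hzD, hzw⟩, ⟨i, hi, him, hyi⟩, hw, hRY, hRX⟩ :=
        hG.exists_path (X := {v | ∃ t, q + 1 < t ∧ t < m ∧ v = x t})
          (Y := {v | (v ∈ M ∨ v ∈ N ∨ ∃ t, t < p ∧ v = x t) ∧ v ≠ x (q + 1)})
          (w := x (q + 1)) ⟨_, q + 2, by omega, by omega, rfl⟩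
          ⟨x 0, .inr (.inr ⟨0, hp, rfl⟩), fun hc => by
            have := hinj 0 (q + 1) (by omega) (by omega) hc; omega⟩
          (by rintro ⟨t, h1, h2, h3⟩; have := hinj (q + 1) t (by omega) h2 h3; omega)
          (by simp)
      subst hyi
      have hRM : ∀ r ∈ R, r ∈ M → r = z := fun r hr hrM =>
        hRY r hr ⟨.inl hrM, by rintro rfl; exact hw hr⟩
      have hRN : ∀ r ∈ R, r ∈ N → r = z := fun r hr hrN =>
        hRY r hr ⟨.inr (.inl hrN), by rintro rfl; exact hw hr⟩
      have hRa : ∀ t < m, x t ∈ R → x t = z ∨ t = i ∨ (p ≤ t ∧ t ≤ q) := by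
        intro t ht htR
        rcases lt_trichotomy t (q + 1) with h | h | h
        · by_cases htp : t < p
          · exact .inl (hRY _ htR ⟨.inr (.inr ⟨t, htp, rfl⟩), by rintro hc; exact hw (hc ▸ htR)⟩)
          · omega
        · subst h; exact absurd htR hw
        · exact .inr (.inl (hinj t i ht him (hRX _ htR ⟨t, h, ht, rfl⟩)))
      have hMw : IsPathList G (M ++ [x (q + 1)]) h (x (q + 1)) :=
        L.fst.concat (hadj q (by omega)) hwM
      obtain ⟨R', rfl⟩ : ∃ R', R = z :: R' := by
        cases R with
        | nil => exact absurd rfl hR.ne_nil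
        | cons c R' => exact ⟨R', by have := hR.head; simp at this; rw [this]⟩
      have hzR' : z ∉ R' := (List.nodup_cons.1 hR.nodup).1
      -- splicing the new connection into a path through `z`
      have splice : ∀ P P₁ P₂ : List V, ∀ c d : V, P = P₁ ++ z :: P₂ → IsPathList G P c d →
          (∀ r ∈ z :: R', r ∈ P → r = z) → IsPathList G (P₁ ++ z :: R') c (x i) := by
        intro P P₁ P₂ c d hP hPp hdisj
        rcases List.eq_nil_or_concat R' with hR0 | ⟨R₁, e, hR1⟩
        · subst hR0
          have := hR.last
          simp only [List.getLast?_singleton, Option.some.injEq] at this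
          rw [← this]
          exact (hP ▸ hPp).left
        · obtain ⟨b, R₂, hb⟩ : ∃ b R₂, R' = b :: R₂ := by
            cases R' with
            | nil => simp at hR1
            | cons b R₂ => exact ⟨b, R₂, rfl⟩
          rw [hb] at hR hzR' hdisj ⊢
          have h1 := (show IsPathList G ([z] ++ b :: R₂) z (x i) from hR).right
          have hzb : G.Adj z b := by have := hR.chain; simp at this; exact this.1
          have := (hP ▸ hPp).left.append h1 hzb (by
            intro v hv hv'
            have h3 := hdisj v (List.mem_cons_of_mem _ hv') (by
              rw [hP]; simp at hv ⊢; tauto)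
            exact hzR' (h3 ▸ hv'))
          simpa using this
      -- The path met by `R` is cut at `z` and continued along `R`. If this is `M`, the two paths
      -- exchange roles; if it is `N`, then `M` is freed to step to `x (q + 1)`.
      by_cases hzM : z ∈ M
      · obtain ⟨M₁, M₂, hM⟩ := List.append_of_mem hzM
        refine ⟨a, i, N, M₁ ++ z :: R', h', h, L.snd, splice M M₁ M₂ _ _ hM L.fst hRM, ?_,
          L.heads.symm.imp And.symm And.symm, L.ha, hi, him, ?_⟩
        · intro v hv hv'
          rcases List.mem_append.1 hv' with h1 | h1
          · exact L.disj v (hM ▸ List.mem_append_left _ h1) hv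
          · have := hRN v h1 hv
            exact L.disj z hzM (this ▸ hv)
        · intro t ht hmem
          rcases hmem with hmem | hmem
          · have := L.avoid t ht (.inr hmem); omega
          · rcases List.mem_append.1 hmem with h1 | h1
            · have := L.avoid t ht (.inl (hM ▸ List.mem_append_left _ h1)); omega
            · rcases hRa t ht h1 with h2 | h2
              · have := L.avoid t ht (.inl (h2 ▸ hzM)); omega
              · omega
      · have hMR : ∀ v ∈ M ++ [x (q + 1)], v ∉ z :: R' := by
          intro v hv hv'
          rcases List.mem_append.1 hv with h1 | h1
          · exact hzM (hRM v hv' h1 ▸ h1)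
          · exact hw (List.mem_singleton.1 h1 ▸ hv')
        have havM : ∀ t < m, x t ∈ M ++ [x (q + 1)] → t = a ∨ p ≤ t ∧ t ≤ q + 1 := by
          intro t ht htM
          rcases List.mem_append.1 htM with h1 | h1
          · have := L.avoid t ht (.inl h1)
            have : t ≠ q + 1 := by rintro rfl; exact hwM h1
            omega
          · have := hinj t (q + 1) ht (by omega) (List.mem_singleton.1 h1); omega
        by_cases hzN : z ∈ N
        · obtain ⟨N₁, N₂, hN⟩ := List.append_of_mem hzN
          have hwN1 : x (q + 1) ∉ N₁ := by
            intro hc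
            have h1 := L.snd
            have h2 := (hN ▸ h1).right.last_mem
            have h3 := h1.nodup
            rw [hN, List.nodup_append'] at h3
            exact h3.2.2 hc h2
          refine ⟨a, i, M ++ [x (q + 1)], N₁ ++ z :: R', h, h', hMw,
            splice N N₁ N₂ _ _ hN L.snd hRN, ?_, L.heads, L.ha, hi, him, ?_⟩
          · intro v hv hv'
            rcases List.mem_append.1 hv' with h1 | h1
            · rcases List.mem_append.1 hv with h2 | h2
              · exact L.disj v h2 (hN ▸ List.mem_append_left _ h1)
              · exact hwN1 (List.mem_singleton.1 h2 ▸ h1)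
            · exact hMR v hv h1
          · intro t ht hmem
            rcases hmem with hmem | hmem
            · have := havM t ht hmem; omega
            · rcases List.mem_append.1 hmem with h1 | h1
              · have := L.avoid t ht (.inr (hN ▸ List.mem_append_left _ h1)); omega
              · rcases hRa t ht h1 with h2 | h2
                · have := L.avoid t ht (.inr (h2 ▸ hzN)); omega
                · omega
        · obtain ⟨b, hb, hzb⟩ : ∃ t, t < p ∧ z = x t := by tauto
          have hRa' : ∀ t < m, x t ∈ z :: R' → t = b ∨ t = i ∨ p ≤ t ∧ t ≤ q + 1 := by
            intro t ht hmem
            rcases hRa t ht hmem with h2 | h2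
            · have := hinj t b ht (by omega) (h2.trans hzb); omega
            · omega
          -- Now `R` starts at `x b` with `b < p` and is the second path by itself. The path
          -- starting at `x p` is kept, after one more edge if it is `M`, and the one starting at `x
          -- a` is dropped.
          rcases L.heads with ⟨e1, e2⟩ | ⟨e1, e2⟩
          · refine ⟨b, i, N, z :: R', h', z, L.snd, hR, ?_, .inr ⟨e2, hzb⟩, hb, hi, him, ?_⟩
            · intro v hv hv'
              exact hzN (hRN v hv' hv ▸ hv)
            · intro t ht hmem
              rcases hmem with hmem | hmem
              · have := L.avoid t ht (.inr hmem)
                have : t ≠ a := by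
                  rintro rfl
                  exact L.disj _ L.fst.head_mem (e1 ▸ hmem)
                omega
              · have := hRa' t ht hmem; omega
          · refine ⟨b, i, M ++ [x (q + 1)], z :: R', h, z, hMw, hR, hMR, .inr ⟨e1, hzb⟩, hb, hi,
              him, ?_⟩
            intro t ht hmem
            rcases hmem with hmem | hmem
            · have := havM t ht hmem
              have : t ≠ a := by
                rintro rfl
                rcases List.mem_append.1 hmem with h1 | h1
                · exact L.disj _ h1 (e2 ▸ L.snd.head_mem)
                · have := hinj t (q + 1) ht (by omega) (List.mem_singleton.1 h1); omega
              omega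
            · have := hRa' t ht hmem; omega

end Linkage

/-! ### From a long path to a long cycle -/

section LongCycleFromPath

open scoped Classical

universe u

variable {V : Type u} {G : SimpleGraph V}

theorem IsPathList.extend {l : List V} {h : V} {y : ℕ → V} {n : ℕ} (hl : IsPathList G l h (y 0))
    (hadj : ∀ t < n, G.Adj (y t) (y (t + 1)))
    (hinj : ∀ s t, 1 ≤ s → s ≤ n → 1 ≤ t → t ≤ n → y s = y t → s = t)
    (hout : ∀ t, 1 ≤ t → t ≤ n → y t ∉ l) : IsPathList G (l ++ arc y 1 n) h (y n) := by
  rcases Nat.eq_zero_or_pos n with rfl | hn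
  · simpa [arc] using hl
  · have h1 := _root_.arc_isPathList (G := G) (x := y) (i := 1) (n := n)
      (fun s t h1 h2 h3 h4 => hinj s t h1 (by omega) h3 (by omega))
      (fun t _ h2 => hadj t (by omega)) hn
    rw [show 1 + n - 1 = n by omega] at h1
    refine hl.append h1 (hadj 0 hn) ?_
    intro v hv hv'
    obtain ⟨t, h1, h2, rfl⟩ := mem_arc.1 hv'
    exact hout t h1 (by omega) hv

/-- The case of the next lemma in which the neighbours of the two ends cross. -/
theorem exists_long_cyc_of_crossing {x : ℕ → V} {m c : ℕ} (hc : 3 ≤ c) (hcm : c ≤ m)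
    (hinj : ∀ s t, s < m → t < m → x s = x t → s = t)
    (hadj : ∀ t, t + 1 < m → G.Adj (x t) (x (t + 1)))
    (hcard : c ≤ ((Finset.range m).filter fun t => G.Adj (x 0) (x t)).card +
      ((Finset.range m).filter fun t => G.Adj (x (m - 1)) (x t)).card)
    (hcross : ∃ d, 1 ≤ d ∧ ∃ i, i + d < m ∧ G.Adj (x 0) (x (i + d)) ∧ G.Adj (x (m - 1)) (x i)) :
    ∃ l, c ≤ l ∧ HasCyc G l := by
  obtain ⟨hd1, i, him, h0, h1⟩ := Nat.find_spec hcross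
  set d := Nat.find hcross with hd
  have hmin : ∀ e, 1 ≤ e → e < d → ∀ i, i + e < m → G.Adj (x 0) (x (i + e)) →
      ¬ G.Adj (x (m - 1)) (x i) := by
    intro e he hed i h1 h2 h3
    exact Nat.find_min hcross hed ⟨he, i, h1, h2, h3⟩
  -- For `d = 1` the cycle covers everything. For `d ≥ 2` minimality leaves no neighbour of either
  -- end strictly between `i` and `i + d`. The neighbours of `x 0` other than `x (i + d)`, moved
  -- back by one, the neighbours of `x (m - 1)`, and `m - 1` itself are disjoint sets outside this
  -- gap, with at least (|Iu| - 1) + |Iv| + 1 ≥ c elements in total.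
  have hlen : c ≤ i + 1 + (m - (i + d)) := by
    rcases hd1.eq_or_lt with hd1 | hd2
    · omega
    set Iu := (Finset.range m).filter fun t => G.Adj (x 0) (x t) with hIu
    set Iv := (Finset.range m).filter fun t => G.Adj (x (m - 1)) (x t) with hIv
    have mu : ∀ t, t ∈ Iu ↔ t < m ∧ G.Adj (x 0) (x t) := by simp [hIu]
    have mv : ∀ t, t ∈ Iv ↔ t < m ∧ G.Adj (x (m - 1)) (x t) := by simp [hIv]
    have pos : ∀ t ∈ Iu, 1 ≤ t := by
      intro t ht
      rcases Nat.eq_zero_or_pos t with rfl | h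
      · exact absurd ((mu 0).1 ht).2 (G.loopless.irrefl _)
      · exact h
    have hj : i + d ∈ Iu := (mu _).2 ⟨him, h0⟩
    set A := (Iu.erase (i + d)).image (· - 1) with hA
    have cA : A.card = Iu.card - 1 := by
      rw [hA, Finset.card_image_of_injOn, Finset.card_erase_of_mem hj]
      intro s hs t ht hst
      have := pos s (Finset.mem_of_mem_erase hs)
      have := pos t (Finset.mem_of_mem_erase ht)
      simp only at hst
      omega
    have cI : 1 ≤ Iu.card := Finset.card_pos.2 ⟨_, hj⟩
    have d1 : Disjoint A Iv := by
      rw [Finset.disjoint_left]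
      intro s hs hs'
      obtain ⟨t, ht, rfl⟩ := Finset.mem_image.1 hs
      have ht := Finset.mem_of_mem_erase ht
      have := pos t ht
      rw [mu] at ht; rw [mv] at hs'
      exact hmin 1 le_rfl hd2 (t - 1) (by omega) (by rw [Nat.sub_add_cancel this]; exact ht.2) hs'.2
    have d2 : m - 1 ∉ A ∪ Iv := by
      rw [Finset.mem_union, not_or]
      refine ⟨?_, fun h => absurd ((mv _).1 h).2 (G.loopless.irrefl _)⟩
      intro hs
      obtain ⟨t, ht, hts⟩ := Finset.mem_image.1 hs
      have ht := Finset.mem_of_mem_erase ht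
      have := pos t ht
      have := ((mu t).1 ht).1
      omega
    have hsub : insert (m - 1) (A ∪ Iv) ⊆ Finset.range (i + 1) ∪ Finset.Ico (i + d) m := by
      intro s hs
      rw [Finset.mem_union, Finset.mem_range, Finset.mem_Ico]
      rcases Finset.mem_insert.1 hs with rfl | hs
      · omega
      rcases Finset.mem_union.1 hs with hs | hs
      · obtain ⟨t, ht, rfl⟩ := Finset.mem_image.1 hs
        have hne := Finset.ne_of_mem_erase ht
        have ht := (mu t).1 (Finset.mem_of_mem_erase ht)
        have := pos t ((mu t).2 ht)
        by_contra hcon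
        have := hmin (t - i) (by omega) (by omega) i (by omega)
          (by rw [Nat.add_sub_cancel' (by omega)]; exact ht.2)
        exact this h1
      · have ht := (mv s).1 hs
        by_contra hcon
        have := hmin (i + d - s) (by omega) (by omega) s (by omega)
          (by rw [Nat.add_sub_cancel' (by omega)]; exact h0)
        exact this ht.2
    have h3 := Finset.card_le_card hsub
    have h4 := Finset.card_union_le (Finset.range (i + 1)) (Finset.Ico (i + d) m)
    rw [Finset.card_insert_of_notMem d2, Finset.card_union_of_disjoint d1, cA] at h3
    rw [Finset.card_range, Nat.card_Ico] at h4
    omega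
  have hp := arc_isPathList (G := G) (x := x) (i := 0) (n := i + 1)
    (fun s t _ _ _ _ => hinj s t (by omega) (by omega)) (fun t _ _ => hadj t (by omega)) (by omega)
  have hq := (arc_isPathList (G := G) (x := x) (i := i + d) (n := m - (i + d))
    (fun s t _ _ _ _ => hinj s t (by omega) (by omega)) (fun t _ _ => hadj t (by omega))
    (by omega)).reverse
  rw [show i + d + (m - (i + d)) - 1 = m - 1 by omega] at hq
  rw [show 0 + (i + 1) - 1 = i by omega] at hp
  have h2 := hp.append hq h1.symm (by
    intro v hv hv'
    rw [List.mem_reverse, mem_arc] at hv'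
    rw [mem_arc] at hv
    obtain ⟨t, ht1, ht2, rfl⟩ := hv
    obtain ⟨t', ht1', ht2', ht3⟩ := hv'
    have := hinj _ _ (by omega) (by omega) ht3
    omega)
  exact ⟨_, by simpa using hlen, h2.cyc h0.symm (by simp; omega)⟩

/-- In a graph without cut vertices, a long path whose ends have many neighbours on it yields a
long cycle. -/
theorem NoCutVertex.exists_long_cyc_of_seq (hG : NoCutVertex G) {x : ℕ → V} {m c : ℕ} (hc : 3 ≤ c)
    (hcm : c ≤ m) (hinj : ∀ s t, s < m → t < m → x s = x t → s = t)
    (hadj : ∀ t, t + 1 < m → G.Adj (x t) (x (t + 1)))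
    (hcard : c ≤ ((Finset.range m).filter fun t => G.Adj (x 0) (x t)).card +
      ((Finset.range m).filter fun t => G.Adj (x (m - 1)) (x t)).card) :
    ∃ l, c ≤ l ∧ HasCyc G l := by
  by_cases hcross : ∃ d, 1 ≤ d ∧ ∃ i, i + d < m ∧ G.Adj (x 0) (x (i + d)) ∧ G.Adj (x (m - 1)) (x i)
  · exact exists_long_cyc_of_crossing hc hcm hinj hadj hcard hcross
  set Iu := (Finset.range m).filter fun t => G.Adj (x 0) (x t) with hIu
  set Iv := (Finset.range m).filter fun t => G.Adj (x (m - 1)) (x t) with hIv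
  have mu : ∀ t, t ∈ Iu ↔ t < m ∧ G.Adj (x 0) (x t) := by simp [hIu]
  have mv : ∀ t, t ∈ Iv ↔ t < m ∧ G.Adj (x (m - 1)) (x t) := by simp [hIv]
  have hle : ∀ s ∈ Iu, ∀ t ∈ Iv, s ≤ t := by
    intro s hs t ht
    rw [mu] at hs; rw [mv] at ht
    by_contra hst
    exact hcross ⟨s - t, by omega, t, by omega, by rw [Nat.add_sub_cancel' (by omega)]; exact hs.2,
      ht.2⟩
  have u1 : 1 ∈ Iu := (mu 1).2 ⟨by omega, hadj 0 (by omega)⟩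
  have v1 : m - 2 ∈ Iv := (mv _).2 ⟨by omega, by
    have := hadj (m - 2) (by omega)
    rw [show m - 2 + 1 = m - 1 by omega] at this
    exact this.symm⟩
  -- Without a crossing no neighbour of `x 0` comes after a neighbour of `x (m - 1)`; `p` is the
  -- last of the former and `q` the first of the latter.
  obtain ⟨p, hp, hpmax⟩ : ∃ p ∈ Iu, ∀ t ∈ Iu, t ≤ p :=
    ⟨Iu.max' ⟨1, u1⟩, Finset.max'_mem _ _, fun t ht => Finset.le_max' _ t ht⟩
  obtain ⟨q, hq, hqmin⟩ : ∃ q ∈ Iv, ∀ t ∈ Iv, q ≤ t :=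
    ⟨Iv.min' ⟨_, v1⟩, Finset.min'_mem _ _, fun t ht => Finset.min'_le _ t ht⟩
  have hpq := hle p hp q hq
  have hp1 := hpmax 1 u1
  have hqm := hqmin _ v1
  obtain ⟨a, j, M, N, h, h', L⟩ := hG.exists_linked hinj hadj (by omega : 0 < p) hpq
    (by omega : q + 1 < m)
  have hLa := L.ha
  have hLq := L.hq
  have hLj := L.hj
  -- The cycle joins the two linked paths by the segments from `x 0` to `x a`, from `x i₀` to `x p`,
  -- from `x q` to `x b` and from `x j` to `x (m - 1)`, with the edges `x 0 x i₀` and `x b x (m -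
  -- 1)`. By the choice of `i₀` and `b`, no neighbours of `x 0` lie between `a` and `i₀` and none of
  -- `x (m - 1)` between `b` and `j`.
  obtain ⟨i₀, ⟨hi0, hai0⟩, hi0min⟩ : ∃ i₀, (i₀ ∈ Iu ∧ a < i₀) ∧ ∀ t ∈ Iu, a < t → i₀ ≤ t := by
    have hne : (Iu.filter (a < ·)).Nonempty := ⟨p, by simp [hp, hLa]⟩
    exact ⟨(Iu.filter (a < ·)).min' hne, by simpa using Finset.min'_mem _ hne,
      fun t ht hat => Finset.min'_le _ t (by simp [ht, hat])⟩
  obtain ⟨b, ⟨hb, hbj⟩, hbmax⟩ : ∃ b, (b ∈ Iv ∧ b < j) ∧ ∀ t ∈ Iv, t < j → t ≤ b := by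
    have hne : (Iv.filter (· < j)).Nonempty := ⟨q, by simp [hq, hLq]⟩
    exact ⟨(Iv.filter (· < j)).max' hne, by simpa using Finset.max'_mem _ hne,
      fun t ht hat => Finset.le_max' _ t (by simp [ht, hat])⟩
  have hqb := hqmin b hb
  have hi0p := hi0min p hp hLa
  have nM : ∀ t < m, x t ∈ M → t = a ∨ t = j ∨ p ≤ t ∧ t ≤ q := fun t ht h => L.avoid t ht (.inl h)
  have nN : ∀ t < m, x t ∈ N → t = a ∨ t = j ∨ p ≤ t ∧ t ≤ q := fun t ht h => L.avoid t ht (.inr h)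
  have hjM : x j ∉ M := fun h => L.disj _ h L.snd.last_mem
  -- extend the two paths behind `q`
  have hM' := L.fst.extend (G := G) (y := fun t => x (q + t)) (n := b - q)
    (fun t ht => hadj (q + t) (by omega))
    (fun s t _ _ _ _ hst => by have := hinj _ _ (by omega) (by omega) hst; omega)
    (fun t _ _ hmem => by have := nM _ (by omega) hmem; omega)
  have hN' := L.snd.extend (G := G) (y := fun t => x (j + t)) (n := m - 1 - j)
    (fun t ht => hadj (j + t) (by omega))
    (fun s t _ _ _ _ hst => by have := hinj _ _ (by omega) (by omega) hst; omega)
    (fun t _ _ hmem => by have := nN _ (by omega) hmem; omega)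
  simp only [Nat.add_sub_cancel' hqb] at hM'
  simp only [Nat.add_sub_cancel' (show j ≤ m - 1 by omega)] at hN'
  set M' := M ++ arc (fun t => x (q + t)) 1 (b - q) with hM'def
  set N' := N ++ arc (fun t => x (j + t)) 1 (m - 1 - j) with hN'def
  have memM' : ∀ v, v ∈ M' ↔ v ∈ M ∨ ∃ t, q < t ∧ t ≤ b ∧ v = x t := by
    intro v
    rw [hM'def, List.mem_append, mem_arc]
    refine or_congr_right ⟨?_, ?_⟩
    · rintro ⟨t, h1, h2, rfl⟩; exact ⟨q + t, by omega, by omega, rfl⟩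
    · rintro ⟨t, h1, h2, rfl⟩; exact ⟨t - q, by omega, by omega, by congr 1; omega⟩
  have memN' : ∀ v, v ∈ N' ↔ v ∈ N ∨ ∃ t, j < t ∧ t < m ∧ v = x t := by
    intro v
    rw [hN'def, List.mem_append, mem_arc]
    refine or_congr_right ⟨?_, ?_⟩
    · rintro ⟨t, h1, h2, rfl⟩; exact ⟨j + t, by omega, by omega, rfl⟩
    · rintro ⟨t, h1, h2, rfl⟩; exact ⟨t - j, by omega, by omega, by congr 1; omega⟩
  have hbv : G.Adj (x b) (x (m - 1)) := ((mv b).1 hb).2.symm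
  have hK := hM'.append hN'.reverse hbv (by
    intro v hv hv'
    rw [List.mem_reverse, memN'] at hv'
    rw [memM'] at hv
    rcases hv with hv | ⟨t, ht1, ht2, rfl⟩ <;> rcases hv' with hv' | ⟨s, hs1, hs2, hs3⟩
    · exact L.disj v hv hv'
    · subst hs3; have := nM s hs2 hv; omega
    · have := nN t (by omega) hv'; omega
    · have := hinj _ _ (by omega) hs2 hs3; omega)
  obtain ⟨K, hKp, memK⟩ : ∃ K, IsPathList G K (x p) (x a) ∧ ∀ v, v ∈ K ↔ v ∈ M' ∨ v ∈ N' := by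
    rcases L.heads with ⟨e1, e2⟩ | ⟨e1, e2⟩
    · rw [e1, e2] at hK
      exact ⟨_, hK.reverse, by simp [or_comm]⟩
    · rw [e1, e2] at hK
      exact ⟨_, hK, by simp⟩
  have nK : ∀ t < m, x t ∈ K → t = a ∨ p ≤ t := by
    intro t ht hmem
    rw [memK, memM', memN'] at hmem
    rcases hmem with (h1 | ⟨s, h1, h2, h3⟩) | (h1 | ⟨s, h1, h2, h3⟩)
    · have := nM t ht h1; omega
    · have := hinj _ _ ht (by omega) h3; omega
    · have := nN t ht h1; omega
    · have := hinj _ _ ht (by omega) h3; omega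
  have hK1 := hKp.extend (G := G) (y := fun t => x (a - t)) (n := a)
    (fun t ht => by
      have := hadj (a - (t + 1)) (by omega)
      rw [show a - (t + 1) + 1 = a - t by omega] at this
      exact this.symm)
    (fun s t _ _ _ _ hst => by have := hinj _ _ (by omega) (by omega) hst; omega)
    (fun t _ _ hmem => by have := nK _ (by omega) hmem; omega)
  simp only [Nat.sub_self] at hK1
  set K1 := K ++ arc (fun t => x (a - t)) 1 a with hK1def
  have memK1 : ∀ v, v ∈ K1 ↔ v ∈ K ∨ ∃ t, t < a ∧ v = x t := by
    intro v
    rw [hK1def, List.mem_append, mem_arc]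
    refine or_congr_right ⟨?_, ?_⟩
    · rintro ⟨t, h1, h2, rfl⟩; exact ⟨a - t, by omega, rfl⟩
    · rintro ⟨t, h1, rfl⟩; exact ⟨a - t, by omega, by omega, by congr 1; omega⟩
  have hK2 := hK1.reverse.extend (G := G) (y := fun t => x (p - t)) (n := p - i₀)
    (fun t ht => by
      have := hadj (p - (t + 1)) (by omega)
      rw [show p - (t + 1) + 1 = p - t by omega] at this
      exact this.symm)
    (fun s t _ _ _ _ hst => by have := hinj _ _ (by omega) (by omega) hst; omega)
    (fun t _ _ hmem => by
      rw [List.mem_reverse, memK1] at hmem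
      rcases hmem with h1 | ⟨s, h1, h2⟩
      · have := nK _ (by omega) h1; omega
      · have := hinj _ _ (by omega) (by omega) h2; omega)
  simp only [Nat.sub_sub_self hi0p] at hK2
  set K2 := K1.reverse ++ arc (fun t => x (p - t)) 1 (p - i₀) with hK2def
  have hsub : ∀ t ∈ insert 0 Iu ∪ Iv, x t ∈ K2 := by
    intro t ht
    rw [hK2def, List.mem_append, List.mem_reverse, memK1, memK]
    rw [Finset.mem_union, Finset.mem_insert, or_assoc] at ht
    have hlow : t ≤ a → (x t ∈ K ∨ ∃ t_1 < a, x t = x t_1) := by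
      intro hta
      rcases hta.eq_or_lt with rfl | hta
      · exact .inl hKp.last_mem
      · exact .inr ⟨t, hta, rfl⟩
    rw [memK] at hlow
    rcases ht with rfl | ht | ht
    · exact .inl (hlow (Nat.zero_le _))
    · rcases le_or_gt t a with hta | hta
      · exact .inl (hlow hta)
      · have h1 := hi0min t ht hta
        have h2 := hpmax t ht
        rcases h2.eq_or_lt with rfl | h2
        · exact .inl (.inl ((memK _).1 hKp.head_mem))
        · exact .inr (mem_arc.2 ⟨p - t, by omega, by omega, by congr 1; omega⟩)
    · left; left
      have h1 := hqmin t ht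
      have h3 := ((mv t).1 ht).1
      rcases lt_or_ge t j with htj | htj
      · have h2 := hbmax t ht htj
        left
        rw [memM']
        rcases h1.eq_or_lt with rfl | h1
        · exact .inl L.fst.last_mem
        · exact .inr ⟨t, h1, h2, rfl⟩
      · right
        rw [memN']
        rcases htj.eq_or_lt with rfl | h1
        · exact .inl L.snd.last_mem
        · exact .inr ⟨t, h1, h3, rfl⟩
  -- The cycle contains `x 0` and every neighbour counted in `Iu` or `Iv`. These two sets share at
  -- most `p`, and the extra vertex `x 0` makes up for it.
  have hlen : c ≤ K2.length := by
    have hIm : insert 0 Iu ∪ Iv ⊆ Finset.range m := by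
      intro t ht
      rw [Finset.mem_union, Finset.mem_insert] at ht
      rw [Finset.mem_range]
      rcases ht with (rfl | ht) | ht
      exacts [by omega, ((mu t).1 ht).1, ((mv t).1 ht).1]
    have h1 : ((insert 0 Iu ∪ Iv).image x) ⊆ K2.toFinset := by
      intro v hv
      obtain ⟨t, ht, rfl⟩ := Finset.mem_image.1 hv
      exact List.mem_toFinset.2 (hsub t ht)
    have h2 := Finset.card_le_card h1
    rw [List.toFinset_card_of_nodup hK2.nodup, Finset.card_image_of_injOn] at h2
    swap
    · intro s hs t ht hst
      exact hinj s t (Finset.mem_range.1 (hIm hs)) (Finset.mem_range.1 (hIm ht)) hst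
    have h3 := Finset.card_union_add_card_inter (insert 0 Iu) Iv
    have h4 : (insert 0 Iu ∩ Iv) ⊆ {p} := by
      intro t ht
      rw [Finset.mem_inter, Finset.mem_insert] at ht
      rw [Finset.mem_singleton]
      have := hqmin t ht.2
      rcases ht.1 with rfl | h5
      · omega
      · have := hpmax t h5; omega
    have h5 := Finset.card_le_card h4
    have h6 : 0 ∉ Iu := fun h => absurd ((mu 0).1 h).2 (G.loopless.irrefl _)
    rw [Finset.card_insert_of_notMem h6] at h3
    rw [Finset.card_singleton] at h5
    omega
  exact ⟨_, hlen, hK2.cyc ((mu i₀).1 hi0).2.symm (by omega)⟩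

/-- The vertices of a path as a sequence. -/
theorem IsPathList.exists_seq {P : List V} {u v : V} (hP : IsPathList G P u v) :
    ∃ x : ℕ → V, (∀ s t, s < P.length → t < P.length → x s = x t → s = t) ∧
      (∀ t, t + 1 < P.length → G.Adj (x t) (x (t + 1))) ∧ x 0 = u ∧ x (P.length - 1) = v ∧
      ∀ w, ((Finset.range P.length).filter fun t => G.Adj w (x t)).card =
        inDeg G P.toFinset w := by
  have hget : ∀ t (ht : t < P.length), P.getD t u = P[t] := fun t ht => by simp [ht]
  have hpos := hP.length_pos
  refine ⟨fun t => P.getD t u, ?_, ?_, ?_, ?_, ?_⟩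
  · intro s t hs ht hst
    simp only [hget s hs, hget t ht] at hst
    exact hP.nodup.getElem_inj_iff.1 hst
  · intro t ht
    simp only [hget t (by omega), hget (t + 1) ht]
    exact hP.getElem_adj t ht
  · simp only; rw [hget 0 hpos, hP.getElem_zero]
  · simp only; rw [hget _ (by omega), hP.getElem_last]
  · intro w
    have h1 : P.toFinset = (Finset.range P.length).image (fun t => P.getD t u) := by
      ext y
      rw [List.mem_toFinset, Finset.mem_image, List.mem_iff_getElem]
      constructor
      · rintro ⟨i, hi, rfl⟩; exact ⟨i, Finset.mem_range.2 hi, hget i hi⟩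
      · rintro ⟨i, hi, rfl⟩
        exact ⟨i, Finset.mem_range.1 hi, (hget i (Finset.mem_range.1 hi)).symm⟩
    rw [inDeg, h1, Finset.filter_image, Finset.card_image_of_injOn]
    intro s hs t ht hst
    simp only [Finset.coe_filter, Finset.mem_range, Set.mem_ofPred_eq] at hs ht
    simp only [hget s hs.1, hget t ht.1] at hst
    exact hP.nodup.getElem_inj_iff.1 hst

theorem NoCutVertex.exists_long_cyc_of_path (hG : NoCutVertex G) {P : List V} {u v : V} {c : ℕ}
    (hP : IsPathList G P u v) (hc : 3 ≤ c) (hcm : c ≤ P.length)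
    (hcard : c ≤ inDeg G P.toFinset u + inDeg G P.toFinset v) : ∃ l, c ≤ l ∧ HasCyc G l := by
  obtain ⟨x, hinj, hadj, h0, h1, hdeg⟩ := hP.exists_seq
  exact hG.exists_long_cyc_of_seq hc hcm hinj hadj (by rw [h0, h1, hdeg, hdeg]; exact hcard)

/-- A Hamiltonian path with large degree sum of its ends yields a Hamiltonian cycle. -/
theorem IsPathList.exists_cyc_of_inDeg {P : List V} {u v : V} (hP : IsPathList G P u v)
    (h3 : 3 ≤ P.length) (hcard : P.length ≤ inDeg G P.toFinset u + inDeg G P.toFinset v) :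
    ∃ l, P.length ≤ l ∧ HasCyc G l := by
  obtain ⟨x, hinj, hadj, h0, h1, hdeg⟩ := hP.exists_seq
  set m := P.length
  rw [← hdeg, ← hdeg, ← h0, ← h1] at hcard
  -- No connectivity is needed: without a crossing at distance 1, `Iu` moved back by one and `Iv`
  -- would be disjoint subsets of only `m - 1` positions.
  refine exists_long_cyc_of_crossing h3 le_rfl hinj hadj hcard ⟨1, le_rfl, ?_⟩
  by_contra! hno
  set Iu := (Finset.range m).filter fun t => G.Adj (x 0) (x t) with hIu
  set Iv := (Finset.range m).filter fun t => G.Adj (x (m - 1)) (x t) with hIv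
  have mu : ∀ t, t ∈ Iu ↔ t < m ∧ G.Adj (x 0) (x t) := by simp [hIu]
  have mv : ∀ t, t ∈ Iv ↔ t < m ∧ G.Adj (x (m - 1)) (x t) := by simp [hIv]
  have pos : ∀ t ∈ Iu, 1 ≤ t := by
    intro t ht
    rcases Nat.eq_zero_or_pos t with rfl | h
    · exact absurd ((mu 0).1 ht).2 (G.loopless.irrefl _)
    · exact h
  have c1 : (Iu.image (· - 1)).card = Iu.card := by
    apply Finset.card_image_of_injOn
    intro s hs t ht hst
    have := pos s hs
    have := pos t ht
    simp only at hst
    omega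
  have d1 : Disjoint (Iu.image (· - 1)) Iv := by
    rw [Finset.disjoint_left]
    intro s hs hs'
    obtain ⟨t, ht, rfl⟩ := Finset.mem_image.1 hs
    have := pos t ht
    have ht := (mu t).1 ht
    exact hno (t - 1) (by omega) (by rw [Nat.sub_add_cancel this]; exact ht.2) ((mv _).1 hs').2
  have hsub : Iu.image (· - 1) ∪ Iv ⊆ Finset.range (m - 1) := by
    intro s hs
    rw [Finset.mem_range]
    rcases Finset.mem_union.1 hs with hs | hs
    · obtain ⟨t, ht, rfl⟩ := Finset.mem_image.1 hs
      have := pos t ht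
      have ht := (mu t).1 ht
      omega
    · have ht := (mv s).1 hs
      have : s ≠ m - 1 := by rintro rfl; exact G.loopless.irrefl _ ht.2
      omega
  have h2 := Finset.card_le_card hsub
  rw [Finset.card_union_of_disjoint d1, c1, Finset.card_range] at h2
  omega

end LongCycleFromPath

/-! ### Saturated graphs and Kopylov's dichotomy -/

section Saturated

open scoped Classical

universe u

variable {V : Type u} {G : SimpleGraph V}

/-- `G` has no cycle of length at least `c`. -/
def NoLongCyc (G : SimpleGraph V) (c : ℕ) : Prop := ∀ l, c ≤ l → ¬ HasCyc G l

/-- Any two distinct nonadjacent vertices are joined by a path with at least `c` vertices. -/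
def LongPathSaturated (G : SimpleGraph V) (c : ℕ) : Prop :=
  ∀ u v, u ≠ v → ¬ G.Adj u v → ∃ P, IsPathList G P u v ∧ c ≤ P.length

/-- In an edge-maximal supergraph without long cycles, adding a missing edge creates a long cycle
through that edge, and the rest of the cycle is the required path. -/
theorem NoLongCyc.exists_saturated [Fintype V] {c : ℕ} (h : NoLongCyc G c) :
    ∃ G', G ≤ G' ∧ NoLongCyc G' c ∧ LongPathSaturated G' c := by
  obtain ⟨G', hGG', hmax⟩ := Set.Finite.exists_le_maximal
    (Set.toFinite {H : SimpleGraph V | NoLongCyc H c}) h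
  refine ⟨G', hGG', hmax.1, fun u v huv hadj => ?_⟩
  have hH : ¬ NoLongCyc (G' ⊔ edge u v) c := by
    intro hH
    have := hmax.2 hH le_sup_left
    exact hadj (this (Or.inr ((edge_adj u v u v).2 ⟨.inl ⟨rfl, rfl⟩, huv⟩)))
  simp only [NoLongCyc, not_forall, not_not] at hH
  obtain ⟨l, hcl, hl⟩ := hH
  obtain ⟨f, hf⟩ := hl.exists_isCyc
  have h3 := hf.three_le
  obtain ⟨i, hi⟩ : ∃ i, ¬ G'.Adj (f i) (f (i + 1)) := by
    by_contra! hall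
    exact hmax.1 l hcl (IsCyc.hasCyc ⟨hf.three_le, hf.inj, hf.periodic, hall⟩)
  have hedge : ∀ a b, (G' ⊔ edge u v).Adj a b → ¬ G'.Adj a b →
      (a = u ∧ b = v) ∨ (a = v ∧ b = u) := by
    intro a b hab hnab
    rcases hab with hab | hab
    · exact absurd hab hnab
    · rw [edge_adj] at hab; tauto
  have hg := hf.shift (i + 1)
  set g : ℕ → V := fun j => f (j + (i + 1)) with hgdef
  have g0 : g 0 = f (i + 1) := by simp [hgdef]
  have g1 : g (l - 1) = f i := by
    rw [← hf.periodic i]; simp only [hgdef]; congr 1; omega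
  have huv' := hedge _ _ (hf.adj i) hi
  rw [← g0, ← g1] at huv'
  have hpath : IsPathList G' (arc g 0 l) (g 0) (g (0 + l - 1)) := by
    refine arc_isPathList (fun s t h1 h2 h3 h4 => hg.inj_window h1 (by omega) h3 (by omega)) ?_
      (by omega)
    intro t _ ht
    by_contra hno
    have hinj : ∀ s t, s < l → t < l → g s = g t → s = t := fun s t h2 h4 =>
      hg.inj_window (Nat.zero_le _) (by omega) (Nat.zero_le _) (by omega)
    rcases hedge _ _ (hg.adj t) hno with ⟨e1, e2⟩ | ⟨e1, e2⟩ <;>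
      rcases huv' with ⟨e3, e4⟩ | ⟨e3, e4⟩
    · have := hinj t (l - 1) (by omega) (by omega) (e1.trans e3.symm); omega
    · have a1 := hinj t 0 (by omega) (by omega) (e1.trans e4.symm)
      have a2 := hinj (t + 1) (l - 1) (by omega) (by omega) (e2.trans e3.symm); omega
    · have a1 := hinj t 0 (by omega) (by omega) (e1.trans e4.symm)
      have a2 := hinj (t + 1) (l - 1) (by omega) (by omega) (e2.trans e3.symm); omega
    · have := hinj t (l - 1) (by omega) (by omega) (e1.trans e3.symm); omega
  rw [Nat.zero_add] at hpath
  rcases huv' with ⟨e3, e4⟩ | ⟨e3, e4⟩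
  · rw [e3, e4] at hpath
    exact ⟨_, hpath.reverse, by simpa using hcl⟩
  · rw [e3, e4] at hpath
    exact ⟨_, hpath, by simpa using hcl⟩

/-- In a saturated graph without cut vertices and long cycles, two sets with large inner degrees
are completely joined. -/
theorem LongPathSaturated.adj_of_inDeg [Fintype V] {c : ℕ} (hs : LongPathSaturated G c)
    (hcut : NoCutVertex G) (hno : NoLongCyc G c) (hc : 3 ≤ c) {X Y : Finset V}
    (hdeg : ∀ x ∈ X, ∀ y ∈ Y, c ≤ inDeg G X x + inDeg G Y y) {x y : V} (hx : x ∈ X) (hy : y ∈ Y)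
    (hxy : x ≠ y) : G.Adj x y := by
  by_contra hnadj
  obtain ⟨P, hP, hPc⟩ := hs x y hxy hnadj
  -- Take a longest path over all nonadjacent pairs from `X` and `Y`. A neighbour of `x` in `X` off
  -- the path would extend it: either the longer path closes to a long cycle, or its ends are again
  -- nonadjacent, against maximality. The same holds for `y`, so the inner degrees become degrees
  -- into the path.
  obtain ⟨s, ⟨P, x, y, hx, hy, hxy, hnadj, hP, hPc, hPs⟩, hmax⟩ := exists_greatest
    (P := fun s => ∃ P x y, x ∈ X ∧ y ∈ Y ∧ x ≠ y ∧ ¬ G.Adj x y ∧ IsPathList G P x y ∧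
      c ≤ P.length ∧ P.length = s)
    ⟨_, P, x, y, hx, hy, hxy, hnadj, hP, hPc, rfl⟩ (Fintype.card V)
    (by rintro s ⟨P, x, y, -, -, -, -, hP, -, rfl⟩; exact hP.nodup.length_le_card)
  have e1 : inDeg G X x ≤ inDeg G P.toFinset x := by
    refine Finset.card_le_card fun w hw => ?_
    rw [Finset.mem_filter] at hw ⊢
    refine ⟨?_, hw.2⟩
    by_contra hwP
    rw [List.mem_toFinset] at hwP
    have hwy : w ≠ y := by rintro rfl; exact hwP hP.last_mem
    have hP' := hP.cons hw.2.symm hwP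
    by_cases hwa : G.Adj w y
    · exact hno _ (by simp; omega) (hP'.cyc hwa.symm (by simp; omega))
    · have := hmax (s + 1) ⟨_, w, y, hw.1, hy, hwy, hwa, hP', by simp; omega, by simp [hPs]⟩
      omega
  have e2 : inDeg G Y y ≤ inDeg G P.toFinset y := by
    refine Finset.card_le_card fun w hw => ?_
    rw [Finset.mem_filter] at hw ⊢
    refine ⟨?_, hw.2⟩
    by_contra hwP
    rw [List.mem_toFinset] at hwP
    have hwx : x ≠ w := by rintro rfl; exact hwP hP.head_mem
    have hP' := hP.concat hw.2 hwP
    by_cases hwa : G.Adj x w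
    · exact hno _ (by simp; omega) (hP'.cyc hwa.symm (by simp; omega))
    · have := hmax (s + 1) ⟨_, x, w, hx, hw.1, hwx, hwa, hP', by simp; omega, by simp [hPs]⟩
      omega
  obtain ⟨l, hl, hcyc⟩ := hcut.exists_long_cyc_of_path hP hc hPc
    (by have := hdeg x hx y hy; omega)
  exact hno l hl hcyc

theorem isPathList_of_clique {S : Finset V} (hS : ∀ x ∈ S, ∀ y ∈ S, x ≠ y → G.Adj x y)
    {l : List V} (hl : l.Nodup) (hlS : ∀ x ∈ l, x ∈ S) {a b : V} (ha : l.head? = some a)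
    (hb : l.getLast? = some b) : IsPathList G l a b := by
  refine ⟨hl, ?_, ha, hb⟩
  apply List.Pairwise.isChain
  exact hl.imp_of_mem fun hx hy hne => hS _ (hlS _ hx) _ (hlS _ hy) hne

theorem hasCyc_of_clique {S : Finset V} (hS : ∀ x ∈ S, ∀ y ∈ S, x ≠ y → G.Adj x y) {l : ℕ}
    (hl : 3 ≤ l) (hlS : l ≤ S.card) : HasCyc G l := by
  obtain ⟨T, hT, hTc⟩ := Finset.exists_subset_card_eq hlS
  have hlen : T.toList.length = l := by rw [Finset.length_toList, hTc]
  obtain ⟨a, L, hL⟩ : ∃ a L, T.toList = a :: L := by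
    cases h : T.toList with
    | nil => rw [h] at hlen; simp at hlen; omega
    | cons a L => exact ⟨a, L, rfl⟩
  obtain ⟨b, hb⟩ : ∃ b, T.toList.getLast? = some b := by
    rw [hL, List.getLast?_cons]; exact ⟨_, rfl⟩
  have hp := isPathList_of_clique hS T.nodup_toList (fun x hx => hT (by simpa using hx))
    (by rw [hL]; rfl) hb
  have hmem : ∀ x ∈ T.toList, x ∈ S := fun x hx => hT (by simpa using hx)
  have hab : b ≠ a := by
    rintro rfl
    have h1 := hp.getElem_zero
    have h2 := hp.getElem_last
    have := hp.nodup.getElem_inj_iff.1 (h1.trans h2.symm)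
    omega
  have := hp.cyc (hS _ (hmem _ hp.last_mem) _ (hmem _ hp.head_mem) hab) (by omega)
  rwa [hlen] at this

/-- Peeling `U` down to `T`, each deleted vertex costs at most `2 * a`. -/
theorem degSum_le_of_removable {T U : Finset V} (hTU : T ⊆ U) {a : ℕ}
    (h : ∀ S, T ⊂ S → S ⊆ U → ∃ v ∈ S, v ∉ T ∧ inDeg G S v ≤ a) :
    degSum G U + 2 * a * T.card ≤ degSum G T + 2 * a * U.card := by
  induction hn : U.card generalizing U with
  | zero =>
    have hU := Finset.card_eq_zero.1 hn
    subst hU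
    rw [Finset.subset_empty.1 hTU]; simp
  | succ n ih =>
    rcases hTU.eq_or_ssubset with rfl | hss
    · rw [hn]
    · obtain ⟨v, hv, hvT, hva⟩ := h U hss subset_rfl
      have hc : (U.erase v).card = n := by rw [Finset.card_erase_of_mem hv, hn]; rfl
      have := ih (U := U.erase v) (fun x hx => Finset.mem_erase.2
        ⟨by rintro rfl; exact hvT hx, hTU hx⟩)
        (fun S h1 h2 => h S h1 (h2.trans (Finset.erase_subset _ _))) hc
      rw [degSum_erase hv]
      nlinarith

/-- `G` is `t`-degenerate. -/
def Degenerate (G : SimpleGraph V) (t : ℕ) : Prop :=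
  ∀ S : Finset V, S.Nonempty → ∃ v ∈ S, inDeg G S v ≤ t

theorem inDeg_lt_card {S : Finset V} {v : V} (hv : v ∈ S) : inDeg G S v + 1 ≤ S.card := by
  rw [← inDeg_erase_self]
  have := inDeg_le_card (G := G) (S.erase v) v
  rw [Finset.card_erase_of_mem hv] at this
  have := Finset.card_pos.2 ⟨v, hv⟩
  omega

theorem degSum_le_card (S : Finset V) : degSum G S + S.card ≤ S.card * S.card := by
  have : ∑ v ∈ S, (inDeg G S v + 1) ≤ ∑ v ∈ S, S.card :=
    Finset.sum_le_sum fun v hv => inDeg_lt_card hv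
  simpa [Finset.sum_add_distrib, degSum] using this

/-- Peeling costs at most `2 * t` per vertex until `t` vertices remain, where the complete graph
bound t(t - 1) takes over. -/
theorem Degenerate.degSum_le {t : ℕ} (h : Degenerate G t) {S : Finset V} (hS : t ≤ S.card) :
    degSum G S + t * t + t ≤ 2 * t * S.card := by
  obtain ⟨k, hk⟩ := Nat.exists_eq_add_of_le hS
  induction k generalizing S with
  | zero =>
    have := degSum_le_card (G := G) S
    rw [hk] at this ⊢
    nlinarith
  | succ k ih =>
    obtain ⟨v, hv, hvt⟩ := h S (Finset.card_pos.1 (by omega))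
    have hc : (S.erase v).card = t + k := by rw [Finset.card_erase_of_mem hv, hk]; rfl
    have := ih (S := S.erase v) (by omega) hc
    rw [degSum_erase hv]
    rw [hc] at this
    rw [hk]
    nlinarith

/-- Kopylov's dichotomy: a saturated graph without cut vertices and without cycles of length at
least `c` is degenerate, or it has few edges and a vertex of small degree. -/
theorem LongPathSaturated.degenerate_or [Fintype V] {c t : ℕ} (hs : LongPathSaturated G c)
    (hcut : NoCutVertex G) (hno : NoLongCyc G c) (hc : 3 ≤ c) (hcV : c ≤ Fintype.card V)
    (ht : c ≤ 2 * t + 2) :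
    Degenerate G t ∨ ∃ a r, a + r = c ∧ t + 2 ≤ r ∧
      degSum G Finset.univ + r + 2 * a * r ≤ r * r + 2 * a * Fintype.card V ∧
      ∃ v, inDeg G Finset.univ v ≤ a := by
  by_cases hdeg : Degenerate G t
  · exact .inl hdeg
  right
  simp only [Degenerate, not_forall, not_exists, not_and, not_le] at hdeg
  obtain ⟨S₀, hS₀, hS₀t⟩ := hdeg
  -- `H` is a largest set with all inner degrees above `t`. Since `2 * (t + 1) ≥ c`, saturation
  -- makes it a clique, and therefore `r < c`.
  obtain ⟨r, ⟨H, ⟨hHne, hHt⟩, hHr⟩, hHmax⟩ := exists_greatest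
    (P := fun s => ∃ S : Finset V, (S.Nonempty ∧ ∀ v ∈ S, t < inDeg G S v) ∧ S.card = s)
    ⟨_, S₀, ⟨hS₀, hS₀t⟩, rfl⟩ (Fintype.card V) (by rintro s ⟨S, -, rfl⟩; exact S.card_le_univ)
  have hclique : ∀ x ∈ H, ∀ y ∈ H, x ≠ y → G.Adj x y := fun x hx y hy hxy =>
    hs.adj_of_inDeg hcut hno hc (fun x hx y hy => by
      have := hHt x hx; have := hHt y hy; omega) hx hy hxy
  have hrc : r < c := by
    by_contra hcr
    exact hno c le_rfl (hasCyc_of_clique hclique hc (by omega))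
  have hHdeg : ∀ y ∈ H, inDeg G H y = r - 1 := by
    intro y hy
    rw [inDeg, ← hHr, ← Finset.card_erase_of_mem hy]
    congr 1
    ext z
    rw [Finset.mem_filter, Finset.mem_erase]
    exact ⟨fun h => ⟨h.2.ne', h.1⟩, fun h => ⟨h.2, hclique y hy z h.2 h.1.symm⟩⟩
  have hrt : t + 2 ≤ r := by
    obtain ⟨y, hy⟩ := hHne
    have h1 := hHt y hy
    rw [hHdeg y hy] at h1
    omega
  -- Otherwise all inner degrees in `S` are at least `c - r + 1`; inside `H` this follows from `2 *
  -- r ≥ c + 2`. Together with the degrees `r - 1` in `H` the sum is `c`, so a vertex of `S` outside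
  -- `H` is joined to all of `H` and enlarges it.
  have hrem : ∀ S, H ⊂ S → S ⊆ Finset.univ → ∃ v ∈ S, v ∉ H ∧ inDeg G S v ≤ c - r := by
    intro S hHS _
    by_contra! hbig
    obtain ⟨w, hwS, hwH⟩ := Finset.exists_of_ssubset hHS
    have hSdeg : ∀ x ∈ S, c - r + 1 ≤ inDeg G S x := by
      intro x hx
      by_cases hxH : x ∈ H
      · have := inDeg_mono (G := G) hHS.1 x
        rw [hHdeg x hxH] at this
        omega
      · exact hbig x hx hxH
    have hwadj : ∀ y ∈ H, G.Adj w y := fun y hy =>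
      hs.adj_of_inDeg hcut hno hc (fun x hx y hy => by
        have := hSdeg x hx; have := hHdeg y hy; omega) hwS hy (by rintro rfl; exact hwH hy)
    have := hHmax (r + 1) ⟨insert w H, ⟨Finset.insert_nonempty _ _, ?_⟩, by
      rw [Finset.card_insert_of_notMem hwH, hHr]⟩
    · omega
    · intro v hv
      rcases Finset.mem_insert.1 hv with rfl | hvH
      · have : H ⊆ (insert v H).filter (G.Adj v) := fun y hy =>
          Finset.mem_filter.2 ⟨Finset.mem_insert_of_mem hy, hwadj y hy⟩
        have := Finset.card_le_card this
        rw [hHr] at this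
        rw [inDeg]; omega
      · exact (hHt v hvH).trans_le (inDeg_mono (Finset.subset_insert _ _) v)
  have hHV : H ⊂ Finset.univ := by
    refine (Finset.subset_univ H).ssubset_of_ne ?_
    rintro rfl
    rw [Finset.card_univ] at hHr
    omega
  refine ⟨c - r, r, by omega, hrt, ?_, ?_⟩
  · have h1 := degSum_le_of_removable (Finset.subset_univ H) hrem
    have h2 := degSum_le_card (G := G) H
    rw [hHr] at h1 h2
    rw [Finset.card_univ] at h1
    omega
  · obtain ⟨v, -, -, hv⟩ := hrem _ hHV subset_rfl
    exact ⟨v, hv⟩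

end Saturated

/-! ### Joins of a clique with an edgeless graph -/

section JoinStructure

open scoped Classical

universe u

variable {V : Type u} {G : SimpleGraph V}

theorem exists_mem_ne_of_two_le_card {S : Finset V} (h : 2 ≤ S.card) (a : V) :
    ∃ b ∈ S, b ≠ a :=
  Finset.exists_mem_ne (by omega) a

/-- Between two completely joined sets there is an alternating path of any even order. -/
theorem exists_alternating_path {A B : Finset V} (hAB : Disjoint A B)
    (hadj : ∀ a ∈ A, ∀ b ∈ B, G.Adj a b) {b : ℕ} (hb : 1 ≤ b) (hbA : b ≤ A.card)
    (hbB : b ≤ B.card) {α β : V} (hα : α ∈ A) (hβ : β ∈ B) :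
    ∃ l, IsPathList G l α β ∧ l.length = 2 * b ∧ ∀ x ∈ l, x ∈ A ∨ x ∈ B := by
  induction b, hb using Nat.le_induction generalizing A B α β with
  | base =>
    refine ⟨[α, β], (IsPathList.single α).concat (hadj α hα β hβ) ?_, rfl, ?_⟩
    · rw [List.mem_singleton]
      rintro rfl
      exact Finset.disjoint_left.1 hAB hα hβ
    · simp only [List.mem_cons, List.not_mem_nil, or_false]
      rintro x (rfl | rfl)
      exacts [.inl hα, .inr hβ]
  | succ b hb ih =>
    obtain ⟨α', hα', hαα'⟩ := exists_mem_ne_of_two_le_card (by omega : 2 ≤ A.card) α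
    obtain ⟨β', hβ', hββ'⟩ := exists_mem_ne_of_two_le_card (by omega : 2 ≤ B.card) β
    obtain ⟨l, hl, hlen, hmem⟩ := ih (A := A.erase α) (B := B.erase β')
      (hAB.mono (Finset.erase_subset _ _) (Finset.erase_subset _ _))
      (fun a ha b hb => hadj a (Finset.mem_of_mem_erase ha) b (Finset.mem_of_mem_erase hb))
      (by rw [Finset.card_erase_of_mem hα]; omega) (by rw [Finset.card_erase_of_mem hβ']; omega)
      (Finset.mem_erase.2 ⟨hαα', hα'⟩) (Finset.mem_erase.2 ⟨hββ'.symm, hβ⟩)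
    have h1 : β' ∉ l := by
      intro h
      rcases hmem _ h with h | h
      · exact Finset.disjoint_left.1 hAB (Finset.mem_of_mem_erase h) hβ'
      · simp at h
    have h2 : α ∉ β' :: l := by
      rw [List.mem_cons, not_or]
      refine ⟨by rintro rfl; exact Finset.disjoint_left.1 hAB hα hβ', fun h => ?_⟩
      rcases hmem _ h with h | h
      · simp at h
      · exact Finset.disjoint_left.1 hAB hα (Finset.mem_of_mem_erase h)
    refine ⟨α :: β' :: l, (hl.cons (hadj _ hα' _ hβ').symm h1).cons (hadj _ hα _ hβ') h2,
      by simp [hlen]; ring, ?_⟩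
    simp only [List.mem_cons]
    rintro x (rfl | rfl | hx)
    exacts [.inl hα, .inr hβ', (hmem x hx).imp Finset.mem_of_mem_erase Finset.mem_of_mem_erase]

/-- Completely joined sets contain even cycles. -/
theorem hasCyc_even_of_join {A B : Finset V} (hAB : Disjoint A B)
    (hadj : ∀ a ∈ A, ∀ b ∈ B, G.Adj a b) {b : ℕ} (hb : 2 ≤ b) (hbA : b ≤ A.card)
    (hbB : b ≤ B.card) : HasCyc G (2 * b) := by
  obtain ⟨α, hα⟩ := Finset.card_pos.1 (by omega : 0 < A.card)
  obtain ⟨β, hβ⟩ := Finset.card_pos.1 (by omega : 0 < B.card)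
  obtain ⟨l, hl, hlen, -⟩ := exists_alternating_path hAB hadj (by omega) hbA hbB hα hβ
  have := hl.cyc (hadj α hα β hβ).symm (by omega)
  rwa [hlen] at this

/-- A vertex outside two completely joined sets with a neighbour in each closes odd cycles. -/
theorem hasCyc_odd_of_join {A B : Finset V} (hAB : Disjoint A B)
    (hadj : ∀ a ∈ A, ∀ b ∈ B, G.Adj a b) {b : ℕ} (hb : 1 ≤ b) (hbA : b ≤ A.card)
    (hbB : b ≤ B.card) {v α β : V} (hvA : v ∉ A) (hvB : v ∉ B) (hα : α ∈ A) (hβ : β ∈ B)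
    (hvα : G.Adj v α) (hvβ : G.Adj v β) : HasCyc G (2 * b + 1) := by
  obtain ⟨l, hl, hlen, hmem⟩ := exists_alternating_path hAB hadj hb hbA hbB hα hβ
  have hv : v ∉ l := fun h => (hmem v h).elim hvA hvB
  have := (hl.cons hvα hv).cyc hvβ.symm (by simp; omega)
  simpa [hlen] using this

/-- A clique of order `t` joined to `t` further vertices contains all cycles of length up to
`2 * t`. -/
theorem hasCyc_of_clique_join {T I : Finset V} (hTI : Disjoint T I)
    (hT : ∀ x ∈ T, ∀ y ∈ T, x ≠ y → G.Adj x y) (hadj : ∀ a ∈ T, ∀ b ∈ I, G.Adj a b)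
    (hI : T.card ≤ I.card) {l : ℕ} (hl : 3 ≤ l) (hlT : l ≤ 2 * T.card) : HasCyc G l := by
  rcases Nat.even_or_odd' l with ⟨b, rfl | rfl⟩
  · exact hasCyc_even_of_join hTI hadj (by omega) (by omega) (by omega)
  · obtain ⟨t, ht⟩ := Finset.card_pos.1 (by omega : 0 < T.card)
    obtain ⟨α, hα, hαt⟩ := exists_mem_ne_of_two_le_card (by omega : 2 ≤ T.card) t
    obtain ⟨β, hβ⟩ := Finset.card_pos.1 (by omega : 0 < I.card)
    exact hasCyc_odd_of_join (A := T.erase t) (hTI.mono_left (Finset.erase_subset _ _))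
      (fun a ha b hb => hadj a (Finset.mem_of_mem_erase ha) b hb) (by omega)
      (by rw [Finset.card_erase_of_mem ht]; omega) (by omega) (by simp)
      (Finset.disjoint_left.1 hTI ht) (Finset.mem_erase.2 ⟨hαt, hα⟩) hβ (hT _ ht _ hα hαt.symm)
      (hadj _ ht _ hβ)

/-- A further vertex with a neighbour in the independent part creates a longer cycle. -/
theorem hasCyc_of_clique_join_of_adj {T I : Finset V} (hTI : Disjoint T I)
    (hT : ∀ x ∈ T, ∀ y ∈ T, x ≠ y → G.Adj x y) (hadj : ∀ a ∈ T, ∀ b ∈ I, G.Adj a b)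
    (h2 : 2 ≤ T.card) (hI : T.card ≤ I.card) {v w y : V} (hvT : v ∉ T) (hvI : v ∉ I)
    (hw : w ∈ I) (hvw : G.Adj v w) (hy : y ∈ T ∨ y ∈ I) (hyw : y ≠ w) (hvy : G.Adj v y) :
    HasCyc G (2 * T.card + 1) := by
  rcases hy with hy | hy
  · exact hasCyc_odd_of_join hTI hadj (by omega) le_rfl hI hvT hvI hy hw hvy hvw
  -- The cycle is `v`, `w`, `t`, followed by an alternating path of order `2 * (T.card - 1)` from
  -- `α` to `y` that avoids `t` and `w`.
  · obtain ⟨t, ht⟩ := Finset.card_pos.1 (by omega : 0 < T.card)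
    obtain ⟨α, hα, hαt⟩ := exists_mem_ne_of_two_le_card h2 t
    have htI := Finset.disjoint_left.1 hTI ht
    obtain ⟨l, hl, hlen, hmem⟩ := exists_alternating_path (G := G) (A := T.erase t)
      (B := I.erase w) (b := T.card - 1) (α := α) (β := y)
      (hTI.mono (Finset.erase_subset _ _) (Finset.erase_subset _ _))
      (fun a ha b hb => hadj a (Finset.mem_of_mem_erase ha) b (Finset.mem_of_mem_erase hb))
      (by omega) (by rw [Finset.card_erase_of_mem ht])
      (by rw [Finset.card_erase_of_mem hw]; omega) (Finset.mem_erase.2 ⟨hαt, hα⟩)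
      (Finset.mem_erase.2 ⟨hyw, hy⟩)
    have hmem' : ∀ x ∈ l, (x ≠ t ∧ x ≠ w) ∧ (x ∈ T ∨ x ∈ I) := by
      intro x hx
      rcases hmem x hx with h | h
      · rw [Finset.mem_erase] at h
        exact ⟨⟨h.1, fun e => Finset.disjoint_left.1 hTI h.2 (e ▸ hw)⟩, .inl h.2⟩
      · rw [Finset.mem_erase] at h
        exact ⟨⟨fun e => htI (e ▸ h.2), h.1⟩, .inr h.2⟩
    have h1 := hl.cons (hT _ ht _ hα hαt.symm) (fun h => (hmem' _ h).1.1 rfl)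
    have h3 := h1.cons (c := w) (hadj _ ht _ hw).symm (by
      rw [List.mem_cons, not_or]
      exact ⟨fun e => htI (e ▸ hw), fun h => (hmem' _ h).1.2 rfl⟩)
    have h4 := h3.cons (c := v) hvw (by
      simp only [List.mem_cons, not_or]
      exact ⟨hvw.ne, fun e => hvT (e ▸ ht), fun h => (hmem' _ h).2.elim hvT hvI⟩)
    have := h4.cyc hvy.symm (by simp)
    convert this using 1
    simp only [List.length_cons, hlen]
    omega

/-- This undoes saturation: an extremal graph has no room for further edges. -/
theorem eq_of_le_of_degSum [Fintype V] {G' : SimpleGraph V} (hG : G ≤ G')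
    (hD : degSum G' Finset.univ ≤ degSum G Finset.univ) : G = G' := by
  have hle : ∀ v ∈ Finset.univ, inDeg G Finset.univ v ≤ inDeg G' Finset.univ v := fun _ _ =>
    Finset.card_le_card (Finset.monotone_filter_right _ fun _ _ h => hG h)
  have heq := (Finset.sum_eq_sum_iff_of_le hle).1 (le_antisymm (Finset.sum_le_sum hle) hD)
  refine le_antisymm hG fun v w hvw => ?_
  have h1 : Finset.univ.filter (G.Adj v) = Finset.univ.filter (G'.Adj v) :=
    Finset.eq_of_subset_of_card_le (Finset.monotone_filter_right _ fun _ _ h => hG h)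
      (heq v (Finset.mem_univ v)).ge
  have : w ∈ Finset.univ.filter (G'.Adj v) := by simp [hvw]
  rw [← h1] at this
  simpa using this

theorem degSum_mono [Fintype V] {G' : SimpleGraph V} (hG : G ≤ G') :
    degSum G Finset.univ ≤ degSum G' Finset.univ :=
  Finset.sum_le_sum fun _ _ =>
    Finset.card_le_card (Finset.monotone_filter_right _ fun _ _ h => hG h)

/-- The extremal non-Hamiltonian graphs of odd order `2 * t + 1` with minimum degree `t`. -/
theorem NoLongCyc.join_structure_of_card [Fintype V] {t : ℕ} (ht : 1 ≤ t)
    (hV : Fintype.card V = 2 * t + 1) (hno : NoLongCyc G (2 * t + 1))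
    (hdeg : ∀ v, t ≤ inDeg G Finset.univ v)
    (hD : 3 * (t * t) + t ≤ degSum G Finset.univ) :
    ∃ T : Finset V, T.card = t ∧ ∀ x y, G.Adj x y ↔ x ≠ y ∧ (x ∈ T ∨ y ∈ T) := by
  obtain ⟨G', hGG', hno', hsat⟩ := hno.exists_saturated
  have hdeg' : ∀ v, t ≤ inDeg G' Finset.univ v := fun v => (hdeg v).trans
    (Finset.card_le_card (Finset.monotone_filter_right _ fun w _ h => hGG' h))
  -- The path supplied by saturation is Hamiltonian. As there is no Hamiltonian cycle, the degrees
  -- of its ends sum to at most `2 * t`, so both equal the minimum `t`. Vertices of larger degree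
  -- are thus adjacent to all others.
  have hnadj : ∀ u v, u ≠ v → ¬ G'.Adj u v →
      inDeg G' Finset.univ u = t ∧ inDeg G' Finset.univ v = t := by
    intro u v huv hadj
    obtain ⟨P, hP, hPl⟩ := hsat u v huv hadj
    have hPle := hP.nodup.length_le_card
    have hPu : P.toFinset = Finset.univ := by
      rw [← Finset.card_eq_iff_eq_univ, List.toFinset_card_of_nodup hP.nodup]; omega
    have h1 : ¬ P.length ≤ inDeg G' P.toFinset u + inDeg G' P.toFinset v := by
      intro h
      obtain ⟨l, hl, hc⟩ := hP.exists_cyc_of_inDeg (by omega) h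
      exact hno' l (by omega) hc
    rw [hPu] at h1
    have := hdeg' u; have := hdeg' v
    omega
  set U := Finset.univ.filter fun v => t < inDeg G' Finset.univ v with hU
  have hUadj : ∀ u ∈ U, ∀ v, u ≠ v → G'.Adj u v := by
    intro u hu v huv
    by_contra h
    have := (hnadj u v huv h).1
    rw [hU, Finset.mem_filter] at hu
    omega
  have hUt : ∀ v, v ∉ U → inDeg G' Finset.univ v = t := by
    intro v hv
    have := hdeg' v
    rw [hU, Finset.mem_filter] at hv
    simp at hv
    omega
  have hsubN : ∀ w, w ∉ U → U ⊆ Finset.univ.filter (G'.Adj w) := by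
    intro w hw u hu
    rw [Finset.mem_filter]
    exact ⟨Finset.mem_univ _, (hUadj u hu w (by rintro rfl; exact hw hu)).symm⟩
  obtain ⟨w, hw⟩ : ∃ w, w ∉ U := by
    by_contra! hall
    exact hno' _ le_rfl (hasCyc_of_clique (S := Finset.univ)
      (fun x _ y _ hxy => hUadj x (hall x) y hxy) (by omega) (by rw [Finset.card_univ, hV]))
  have hUle : U.card ≤ t := by
    rw [← hUt w hw]; exact Finset.card_le_card (hsubN w hw)
  have hsum : degSum G' Finset.univ ≤ U.card * (2 * t) + (2 * t + 1 - U.card) * t := by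
    rw [degSum, ← Finset.sum_add_sum_compl U]
    have h1 : ∑ v ∈ U, inDeg G' Finset.univ v ≤ ∑ v ∈ U, 2 * t := Finset.sum_le_sum fun v _ => by
      have := inDeg_lt_card (G := G') (Finset.mem_univ v)
      rw [Finset.card_univ, hV] at this
      omega
    have h2 : ∑ v ∈ Uᶜ, inDeg G' Finset.univ v = ∑ v ∈ Uᶜ, t :=
      Finset.sum_congr rfl fun v hv => hUt v (Finset.mem_compl.1 hv)
    rw [h2]
    rw [Finset.sum_const, smul_eq_mul] at h1 ⊢
    rw [Finset.card_compl, hV]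
    omega
  have hDD := degSum_mono hGG'
  -- The bound `hsum` increases with `U.card` and reaches 3t² + t only at `U.card = t`.
  have hUeq : U.card = t := by
    obtain ⟨s, hs⟩ := Nat.exists_eq_add_of_le hUle
    have h1 : 2 * t + 1 - U.card = t + 1 + s := by omega
    rw [h1] at hsum
    rcases Nat.eq_zero_or_pos s with h0 | h0
    · omega
    · exfalso
      nlinarith [mul_pos (show 0 < t by omega) h0]
  have hGG : G = G' := by
    refine eq_of_le_of_degSum hGG' (hsum.trans (le_trans ?_ hD))
    rw [hUeq, show 2 * t + 1 - t = t + 1 by omega]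
    nlinarith
  refine ⟨U, hUeq, fun x y => ?_⟩
  rw [hGG]
  constructor
  · intro hxy
    refine ⟨hxy.ne, ?_⟩
    by_contra! hc
    have h1 : U = Finset.univ.filter (G'.Adj x) :=
      Finset.eq_of_subset_of_card_le (hsubN x hc.1) (by
        rw [hUeq]; exact (hUt x hc.1).le)
    apply hc.2
    rw [h1]; simp [hxy]
  · rintro ⟨hne, h | h⟩
    · exact hUadj x h y hne
    · exact (hUadj y h x hne.symm).symm

theorem NoLongCyc.subGraph {S : Finset V} {c : ℕ} (h : NoLongCyc G c) :
    NoLongCyc (subGraph G S) c := fun l hl hc => h l hl hc.of_subGraph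

/-- The extremal `t`-degenerate graphs without cycles of length at least `2 * t + 1`. -/
theorem Degenerate.join_structure {t : ℕ} (h : Degenerate G t) (ht : 2 ≤ t)
    (hno : NoLongCyc G (2 * t + 1)) {S : Finset V} (hS : 2 * t + 1 ≤ S.card)
    (hD : 2 * t * S.card ≤ degSum G S + t * t + t) :
    ∃ T ⊆ S, T.card = t ∧ ∀ x ∈ S, ∀ y ∈ S, G.Adj x y ↔ x ≠ y ∧ (x ∈ T ∨ y ∈ T) := by
  obtain ⟨k, hk⟩ := Nat.exists_eq_add_of_le hS
  induction k generalizing S with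
  | zero =>
    -- A vertex of degree below `t` could be deleted, leaving `2 * t` vertices that violate
    -- `Degenerate.degSum_le`.
    obtain ⟨T, hT, hadj⟩ := NoLongCyc.join_structure_of_card (G := subGraph G S) (t := t)
      (by omega) (by rw [Fintype.card_coe]; omega) hno.subGraph
      (by
        rintro ⟨w, hw⟩
        rw [inDeg_subGraph]
        by_contra hlt
        have h1 := degSum_erase (G := G) hw
        have hc := Finset.card_erase_of_mem hw
        have h2 := h.degSum_le (S := S.erase w) (by omega)
        rw [hc] at h2
        rw [show S.card = 2 * t + 1 by omega] at hD h2
        simp only at hlt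
        simp only [Nat.add_sub_cancel] at h2
        nlinarith)
      (by
        rw [degSum_subGraph]
        rw [show S.card = 2 * t + 1 by omega] at hD
        nlinarith)
    refine ⟨T.map (Function.Embedding.subtype _), ?_, by rw [Finset.card_map, hT], ?_⟩
    · intro x hx
      obtain ⟨y, -, rfl⟩ := Finset.mem_map.1 hx
      exact y.2
    · intro x hx y hy
      have := hadj ⟨x, hx⟩ ⟨y, hy⟩
      rw [subGraph_adj] at this
      simp only [this, ne_eq, Subtype.mk.injEq, Finset.mem_map, Function.Embedding.subtype_apply,
        Subtype.exists, exists_and_right, exists_eq_right, hx, hy, exists_true_left]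
  | succ k ih =>
    obtain ⟨v, hv, hvt⟩ := h S (Finset.card_pos.1 (by omega))
    have hc : (S.erase v).card + 1 = S.card := Finset.card_erase_add_one hv
    have hde := degSum_erase (G := G) hv
    have h2 := h.degSum_le (S := S.erase v) (by omega)
    have hSc : 2 * t * S.card = 2 * t * (S.erase v).card + 2 * t := by rw [← hc]; ring
    obtain ⟨T, hTS, hTc, hTadj⟩ := ih (S := S.erase v) (by omega) (by omega) (by omega)
    have hvdeg : inDeg G S v = t := by omega
    set I := S.erase v \ T with hI
    have hIc : I.card = (S.erase v).card - t := by
      rw [hI, Finset.card_sdiff_of_subset hTS, hTc]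
    have hvT : v ∉ T := fun hvT => Finset.notMem_erase v S (hTS hvT)
    have hvI : v ∉ I := by simp [hI]
    -- A neighbour of `v` outside `T`, with a second neighbour available because `t ≥ 2`, would
    -- close a cycle of length `2 * t + 1`.
    have hN : S.filter (G.Adj v) = T := by
      by_contra hne
      have hnsub : ¬ S.filter (G.Adj v) ⊆ T := fun hsub => hne
        (Finset.eq_of_subset_of_card_le hsub (by rw [hTc, ← hvdeg]; rfl))
      obtain ⟨w, hw, hwT⟩ := Finset.not_subset.1 hnsub
      obtain ⟨y, hy, hyw⟩ := exists_mem_ne_of_two_le_card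
        (show 2 ≤ (S.filter (G.Adj v)).card by rw [← inDeg, hvdeg]; exact ht) w
      have hmem : ∀ z ∈ S.filter (G.Adj v), G.Adj v z ∧ (z ∈ T ∨ z ∈ I) := by
        intro z hz
        rw [Finset.mem_filter] at hz
        refine ⟨hz.2, ?_⟩
        rw [hI, Finset.mem_sdiff, Finset.mem_erase]
        have := hz.2.ne'
        tauto
      have hcyc := hasCyc_of_clique_join_of_adj (G := G) (T := T) (I := I) Finset.disjoint_sdiff
        (fun x hx y hy hxy => (hTadj x (hTS hx) y (hTS hy)).2 ⟨hxy, .inl hx⟩)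
        (fun x hx y hy => (hTadj x (hTS hx) y (Finset.sdiff_subset hy)).2
          ⟨by rintro rfl; exact (Finset.mem_sdiff.1 hy).2 hx, .inl hx⟩)
        (by omega) (by omega) hvT hvI ((hmem w hw).2.resolve_left hwT) (hmem w hw).1
        (hmem y hy).2 hyw (hmem y hy).1
      rw [hTc] at hcyc
      exact hno _ le_rfl hcyc
    have hvadj : ∀ z ∈ S, (G.Adj v z ↔ z ∈ T) := by
      intro z hz
      rw [← hN, Finset.mem_filter]
      exact ⟨fun h => ⟨hz, h⟩, fun h => h.2⟩
    refine ⟨T, hTS.trans (Finset.erase_subset _ _), hTc, fun x hx y hy => ?_⟩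
    by_cases hxv : x = v
    · subst hxv
      rw [hvadj y hy]
      exact ⟨fun h => ⟨by rintro rfl; exact hvT h, .inr h⟩, fun h => h.2.resolve_left hvT⟩
    · by_cases hyv : y = v
      · subst hyv
        rw [G.adj_comm, hvadj x hx]
        exact ⟨fun h => ⟨by rintro rfl; exact hvT h, .inl h⟩, fun h => h.2.resolve_right hvT⟩
      · exact hTadj x (Finset.mem_erase.2 ⟨hxv, hx⟩) y (Finset.mem_erase.2 ⟨hyv, hy⟩)

end JoinStructure

/-! ### Graphs of minimum degree at least n - k -/

section LargeMinDegree

open scoped Classical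

universe u

variable {V : Type u} {G : SimpleGraph V}

/-- `G` consists of two cliques that share exactly one vertex, one of them of order `k + 1`. -/
def IsTwoCliques (G : SimpleGraph V) (k : ℕ) : Prop :=
  ∃ (z : V) (A : Finset V), z ∉ A ∧ A.card = k ∧
    ∀ x y, G.Adj x y ↔ x ≠ y ∧ (x = z ∨ y = z ∨ (x ∈ A ↔ y ∈ A))

/-- `G` is complete bipartite and one of its parts has order `k`. -/
def IsCompleteBip (G : SimpleGraph V) (k : ℕ) : Prop :=
  ∃ A : Finset V, A.card = k ∧ ∀ x y, G.Adj x y ↔ (x ∈ A ↔ y ∉ A)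

/-- `G` is the join of a clique of order `t` and an edgeless graph. -/
def IsCliqueJoin (G : SimpleGraph V) (t : ℕ) : Prop :=
  ∃ T : Finset V, T.card = t ∧ ∀ x y, G.Adj x y ↔ x ≠ y ∧ (x ∈ T ∨ y ∈ T)

variable [Fintype V]

/-- A cut vertex would split the rest into two sides of order at least `x + 2`, with degrees bounded
by the order of the side. By convexity the most unbalanced split has the most edges, and even that
is too few. -/
theorem noCutVertex_of_inDeg {k x : ℕ} (hV : Fintype.card V = k + 2 + x)
    (hdeg : ∀ v, x + 2 ≤ inDeg G Finset.univ v)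
    (hD : (k + 1) * k + (x + 2) * (x + 1) ≤ degSum G Finset.univ) : NoCutVertex G := by
  intro w S hwS hS hy
  by_contra! hcon
  set A := Finset.univ.filter (· ∈ S) with hA
  set B := Finset.univ.filter (fun v => v ≠ w ∧ v ∉ S) with hB
  have hAw : w ∉ A := by simpa [hA] using hwS
  have hBw : w ∉ B := by simp [hB]
  have hAB : Disjoint A B := by
    rw [Finset.disjoint_left]; intro v hv hv'; simp [hA, hB] at hv hv'; exact hv'.2 hv
  have hwAB : w ∉ A ∪ B := by simp [hAw, hBw]
  have huniv : insert w (A ∪ B) = Finset.univ := by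
    ext v; simp [hA, hB]; tauto
  have hcard : A.card + B.card + 1 = k + 2 + x := by
    rw [← hV, ← Finset.card_univ, ← huniv, Finset.card_insert_of_notMem hwAB,
      Finset.card_union_of_disjoint hAB]
  have hAdeg : ∀ v ∈ A, inDeg G Finset.univ v ≤ A.card := by
    intro v hv
    have hsub : Finset.univ.filter (G.Adj v) ⊆ insert w (A.erase v) := by
      intro z hz
      rw [Finset.mem_filter] at hz
      rw [Finset.mem_insert, Finset.mem_erase]
      by_cases hzw : z = w
      · exact .inl hzw
      · refine .inr ⟨hz.2.ne', ?_⟩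
        simp only [hA, Finset.mem_filter, Finset.mem_univ, true_and] at hv ⊢
        by_contra hzS
        exact hcon v hv z hzS hzw hz.2
    have h1 := Finset.card_le_card hsub
    have h2 := Finset.card_insert_le w (A.erase v)
    rw [Finset.card_erase_of_mem hv] at h2
    have := Finset.card_pos.2 ⟨v, hv⟩
    rw [inDeg]; omega
  have hBdeg : ∀ v ∈ B, inDeg G Finset.univ v ≤ B.card := by
    intro v hv
    have hsub : Finset.univ.filter (G.Adj v) ⊆ insert w (B.erase v) := by
      intro z hz
      rw [Finset.mem_filter] at hz
      rw [Finset.mem_insert, Finset.mem_erase]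
      by_cases hzw : z = w
      · exact .inl hzw
      · refine .inr ⟨hz.2.ne', ?_⟩
        simp only [hB, Finset.mem_filter, Finset.mem_univ, true_and] at hv ⊢
        refine ⟨hzw, fun hzS => ?_⟩
        exact hcon z hzS v hv.2 hv.1 hz.2.symm
    have h1 := Finset.card_le_card hsub
    have h2 := Finset.card_insert_le w (B.erase v)
    rw [Finset.card_erase_of_mem hv] at h2
    have := Finset.card_pos.2 ⟨v, hv⟩
    rw [inDeg]; omega
  obtain ⟨a, ha⟩ := hS
  obtain ⟨b, hb⟩ := hy
  have h1 := (hdeg a).trans (hAdeg a (by simpa [hA] using ha))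
  have h2 := (hdeg b).trans (hBdeg b (by simpa [hB] using hb))
  have h3 : degSum G Finset.univ ≤ (k + 1 + x) + (A.card * A.card + B.card * B.card) := by
    rw [degSum, ← huniv, Finset.sum_insert hwAB, Finset.sum_union hAB, huniv]
    have e1 : ∑ v ∈ A, inDeg G Finset.univ v ≤ ∑ v ∈ A, A.card := Finset.sum_le_sum hAdeg
    have e2 : ∑ v ∈ B, inDeg G Finset.univ v ≤ ∑ v ∈ B, B.card := Finset.sum_le_sum hBdeg
    have e3 := inDeg_lt_card (G := G) (Finset.mem_univ w)
    rw [Finset.card_univ, hV] at e3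
    simp only [Finset.sum_const, smul_eq_mul] at e1 e2
    omega
  obtain ⟨i, hi⟩ := Nat.exists_eq_add_of_le h1
  obtain ⟨j, hj⟩ := Nat.exists_eq_add_of_le h2
  have hk : k = x + 2 + j + 1 + i := by omega
  rw [hi, hj] at h3
  subst hk
  nlinarith [Nat.zero_le (i * j)]

/-- Kopylov's theorem with its extremal graphs, for graphs of large minimum degree. -/
theorem exists_long_cyc_or_isCliqueJoin {k x : ℕ} (hk : 1 ≤ k)
    (hV : Fintype.card V = k + 2 + x) (hdeg : ∀ v, x + 2 ≤ inDeg G Finset.univ v)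
    (hD : (k + 1) * k + (x + 2) * (x + 1) ≤ degSum G Finset.univ) :
    (∃ l, k + 2 ≤ l ∧ HasCyc G l) ∨ (k + 1 = 2 * (x + 2) ∧
      degSum G Finset.univ = (k + 1) * k + (x + 2) * (x + 1) ∧ IsCliqueJoin G (x + 2)) := by
  by_cases hno : NoLongCyc G (k + 2)
  swap
  · left
    simp only [NoLongCyc, not_forall, not_not] at hno
    obtain ⟨l, h1, h2⟩ := hno
    exact ⟨l, h1, h2⟩
  right
  have hcut := noCutVertex_of_inDeg hV hdeg hD
  obtain ⟨G', hGG', hno', hsat⟩ := hno.exists_saturated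
  have hDD := degSum_mono hGG'
  have hdeg' : ∀ v, x + 2 ≤ inDeg G' Finset.univ v := fun v => (hdeg v).trans
    (Finset.card_le_card (Finset.monotone_filter_right _ fun _ _ h => hGG' h))
  -- `t` is k/2 rounded up, so that `k + 2 ≤ 2 * t + 2`.
  obtain ⟨t, ht⟩ : ∃ t, k = 2 * t ∨ k + 1 = 2 * t := ⟨(k + 1) / 2, by omega⟩
  rcases hsat.degenerate_or (t := t) (hcut.mono hGG') hno' (by omega) (by omega) (by omega) with
    hdg | ⟨a, r, har, htr, hDa, v, hv⟩
  · have h1 := hdg.degSum_le (S := Finset.univ) (by rw [Finset.card_univ]; omega)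
    rw [Finset.card_univ, hV] at h1
    obtain ⟨v, -, hv⟩ := hdg Finset.univ (Finset.card_pos.1 (by rw [Finset.card_univ]; omega))
    obtain ⟨j, hj⟩ := Nat.exists_eq_add_of_le ((hdeg' v).trans hv)
    -- For even `k` the bound for degenerate graphs lies below the hypothesis. For odd `k` they meet
    -- only at `t = x + 2`, with equality throughout.
    rcases ht with rfl | ht
    · exfalso
      subst hj
      nlinarith
    · have hj0 : j = 0 := by
        obtain rfl : k = 2 * t - 1 := by omega
        rw [show 2 * t - 1 + 1 = 2 * t by omega, show 2 * t - 1 = 2 * x + 2 * j + 3 by omega] at hD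
        rw [show 2 * t - 1 + 2 = 2 * x + 2 * j + 5 by omega] at h1
        subst hj
        nlinarith
      subst hj0
      have hkx : k = 2 * x + 3 := by omega
      have htx : t = x + 2 := by omega
      subst hkx htx
      have hDeq : degSum G Finset.univ = (2 * x + 3 + 1) * (2 * x + 3) + (x + 2) * (x + 1) := by
        nlinarith
      have hG : G = G' := eq_of_le_of_degSum hGG' (by nlinarith)
      subst hG
      obtain ⟨T, -, hTc, hT⟩ := hdg.join_structure (by omega) (by
        intro l hl; exact hno l (by omega)) (S := Finset.univ) (by rw [Finset.card_univ]; omega)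
        (by rw [Finset.card_univ, hV]; nlinarith)
      exact ⟨by omega, hDeq, T, hTc, fun x y => hT x (Finset.mem_univ _) y (Finset.mem_univ _)⟩
  · exfalso
    rw [hV] at hDa
    obtain ⟨i, hi⟩ := Nat.exists_eq_add_of_le ((hdeg' v).trans hv)
    obtain ⟨j, hj⟩ := Nat.exists_eq_add_of_le (show a + 2 ≤ r by omega)
    have hk' : k = a + a + j := by omega
    subst hk' hj hi
    nlinarith [Nat.zero_le (i * j), Nat.zero_le (x * j), Nat.zero_le (x * i)]

/-- The theorem for graphs in which no vertex has degree less than `n - k = x + 2`. -/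
theorem hasCyc_or_of_inDeg {k x : ℕ} (hk : 1 ≤ k) (hxk : x + 1 ≤ k)
    (hV : Fintype.card V = k + 2 + x) (hdeg : ∀ v, x + 2 ≤ inDeg G Finset.univ v)
    (hD : (k + 1) * k + (x + 2) * (x + 1) ≤ degSum G Finset.univ) :
    (∀ l, 3 ≤ l → l ≤ k + 2 → HasCyc G l) ∨
      (degSum G Finset.univ = (k + 1) * k + (x + 2) * (x + 1) ∧
        ((k = x + 2 ∧ IsCompleteBip G k) ∨ (k + 1 = 2 * (x + 2) ∧ IsCliqueJoin G (x + 2)))) := by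
  rcases exists_long_cyc_or_isCliqueJoin hk hV hdeg hD with ⟨m, hkm, hm⟩ | ⟨h1, h2, h3⟩
  swap
  · exact .inr ⟨h2, .inr ⟨h1, h3⟩⟩
  by_cases hdense : Fintype.card V * Fintype.card V < 2 * degSum G Finset.univ
  · exact .inl fun l hl hlk => hasCyc_of_dense hdense hm (by omega) hl (by omega)
  rw [hV] at hdense
  -- With `k = x + 1 + y`, the hypothesis exceeds n²/4 edges for `y ≥ 2`. For `y = 0`, where n = 2k
  -- + 1, the minimum degree k + 1 does so.
  have hkx : k = x + 2 := by
    obtain ⟨y, hy⟩ := Nat.exists_eq_add_of_le hxk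
    have hy2 : y ≤ 1 := by
      subst hy
      by_contra hy
      obtain ⟨z, rfl⟩ := Nat.exists_eq_add_of_le (show 2 ≤ y by omega)
      nlinarith
    rcases (show y = 0 ∨ y = 1 by omega) with rfl | rfl
    · exfalso
      have : ∑ v : V, (x + 2) ≤ degSum G Finset.univ := Finset.sum_le_sum fun v _ => hdeg v
      rw [Finset.sum_const, smul_eq_mul, Finset.card_univ, hV] at this
      subst hy
      nlinarith
    · omega
  subst hkx
  have hDeq : degSum G Finset.univ = (x + 2 + 1) * (x + 2) + (x + 2) * (x + 1) := by nlinarith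
  obtain ⟨s, hs, hsmax⟩ := exists_greatest ⟨m, hm⟩ _ fun s h => h.le_card
  have hms := hsmax m hm
  have hsn := hs.le_card
  obtain ⟨f, hf⟩ := hs.exists_isCyc
  have hsV : s = Fintype.card V := by
    by_contra hne
    obtain ⟨v, hv, hdv⟩ := hf.exists_small_degree (fun l hl h => by have := hsmax l h; omega)
      (by omega) (by omega)
    have := hdeg v
    omega
  -- A cycle of length n - 1 misses one vertex, whose degree of at least n/2 is more than half the
  -- cycle. Without such a cycle adjacency is decided by parity along the Hamiltonian cycle.
  by_cases hn1 : HasCyc G (s - 1)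
  · left
    intro l hl hlk
    obtain ⟨g, hg⟩ := hn1.exists_isCyc
    have h3 := hg.three_le
    set C := (Finset.range (s - 1)).image g with hC
    have hCc : Cᶜ.card = 1 := by rw [Finset.card_compl, hg.card_image]; omega
    obtain ⟨v, hv⟩ := Finset.card_eq_one.1 hCc
    have hvC : v ∉ C := by rw [← Finset.mem_compl, hv]; simp
    have hd := inDeg_union_of_disjoint (G := G) (disjoint_compl_right (a := C)) v
    rw [Finset.union_compl, hv] at hd
    have hz : inDeg G {v} v = 0 := by
      have := inDeg_lt_card (G := G) (Finset.mem_singleton_self v)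
      rw [Finset.card_singleton] at this; omega
    have := hdeg v
    exact hg.hasCyc_of_card_posSet (v := v)
      (fun i hi => hvC (hg.mem_image_iff.2 ⟨i, hi⟩)) (by rw [hg.card_posSet, ← hC]; omega) hl
      (by omega)
  · right
    refine ⟨hDeq, .inl ⟨rfl, ?_⟩⟩
    have hs2 : s = 2 * (x + 2) := by omega
    have hadj := fun o => hf.adj_iff_odd hsV.symm ⟨x + 2, by omega⟩ (by omega)
      (fun v => by have := hdeg v; omega) hn1 (o := o)
    set A := (Finset.range (x + 2)).image (fun i => f (2 * i)) with hA
    have hmem : ∀ p < s, (f p ∈ A ↔ Even p) := by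
      intro p hp
      rw [hA, Finset.mem_image]
      constructor
      · rintro ⟨i, hi, hip⟩
        rw [Finset.mem_range] at hi
        have := hf.inj_window (i := 0) (by omega) (by omega) (by omega) (by omega) hip
        exact ⟨i, by omega⟩
      · rintro ⟨i, hi⟩
        exact ⟨i, Finset.mem_range.2 (by omega), by congr 1; omega⟩
    have hlt : ∀ p q, p < q → q < s → (G.Adj (f p) (f q) ↔ (f p ∈ A ↔ f q ∉ A)) := by
      intro p q hpq hq
      have := hadj (q - p) (by omega) (by omega) p
      rw [Nat.add_sub_cancel' hpq.le] at this
      rw [this, hmem p (by omega), hmem q hq, Nat.odd_sub hpq.le, Nat.not_even_iff_odd]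
      exact iff_comm
    refine ⟨A, ?_, fun y z => ?_⟩
    · rw [hA, Finset.card_image_of_injOn, Finset.card_range]
      intro i hi j hj hij
      simp only [Finset.coe_range, Set.mem_Iio] at hi hj
      have := hf.inj_window (i := 0) (by omega) (by omega) (by omega) (by omega) hij
      omega
    · obtain ⟨p, hp, rfl⟩ := hf.surj hsV.symm y
      obtain ⟨q, hq, rfl⟩ := hf.surj hsV.symm z
      rcases lt_trichotomy p q with h | rfl | h
      · exact hlt p q h hq
      · exact iff_of_false (G.loopless.irrefl _) (by tauto)
      · rw [G.adj_comm, hlt q p h hp]; tauto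

end LargeMinDegree

/-! ### Restoring a deleted vertex and the induction -/

section VertexDeletion

open scoped Classical

universe u

variable {V : Type u} {G : SimpleGraph V}

theorem exists_path_of_clique {S : Finset V} (hS : ∀ x ∈ S, ∀ y ∈ S, x ≠ y → G.Adj x y) {p q : V}
    (hp : p ∈ S) (hq : q ∈ S) (hpq : p ≠ q) {j : ℕ} (hj : 2 ≤ j) (hjS : j ≤ S.card) :
    ∃ l, IsPathList G l p q ∧ l.length = j ∧ ∀ x ∈ l, x ∈ S := by
  have hc : j - 2 ≤ ((S.erase p).erase q).card := by
    rw [Finset.card_erase_of_mem (Finset.mem_erase.2 ⟨hpq.symm, hq⟩), Finset.card_erase_of_mem hp]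
    omega
  obtain ⟨T, hT, hTc⟩ := Finset.exists_subset_card_eq hc
  have hpT : p ∉ T := fun h => by have := hT h; simp at this
  have hqT : q ∉ T := fun h => by have := hT h; simp at this
  have hmem : ∀ x ∈ p :: (T.toList ++ [q]), x ∈ S := by
    simp only [List.mem_cons, List.mem_append, Finset.mem_toList, List.not_mem_nil, or_false]
    rintro x (rfl | hx | rfl)
    exacts [hp, Finset.mem_of_mem_erase (Finset.mem_of_mem_erase (hT hx)), hq]
  refine ⟨p :: (T.toList ++ [q]), isPathList_of_clique hS ?_ hmem rfl ?_, ?_, hmem⟩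
  · simp only [List.nodup_cons, List.mem_append, Finset.mem_toList, List.mem_singleton, hpT, hpq,
      or_self, not_false_eq_true, true_and]
    rw [List.nodup_append']
    exact ⟨T.nodup_toList, by simp, by simpa [List.Disjoint] using hqT⟩
  · rw [← List.cons_append, List.getLast?_append]; rfl
  · simp [hTc]; omega

theorem clique_of_degSum {S : Finset V} (h : S.card * S.card ≤ degSum G S + S.card) :
    ∀ x ∈ S, ∀ y ∈ S, x ≠ y → G.Adj x y := by
  intro x hx y hy hxy
  by_contra hadj
  have h1 : inDeg G S x + 2 ≤ S.card := by
    have hsub : S.filter (G.Adj x) ⊆ (S.erase x).erase y := by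
      intro z hz
      rw [Finset.mem_filter] at hz
      rw [Finset.mem_erase, Finset.mem_erase]
      exact ⟨by rintro rfl; exact hadj hz.2, hz.2.ne', hz.1⟩
    have h2 := Finset.card_le_card hsub
    have h3 := Finset.card_erase_add_one (Finset.mem_erase.2 ⟨hxy.symm, hy⟩)
    have h4 := Finset.card_erase_add_one hx
    rw [inDeg]; omega
  have h2 : ∑ v ∈ S, (inDeg G S v + 1) < ∑ v ∈ S, S.card :=
    Finset.sum_lt_sum (fun v hv => inDeg_lt_card hv) ⟨x, hx, by omega⟩
  rw [Finset.sum_add_distrib, Finset.sum_const, Finset.sum_const, smul_eq_mul, smul_eq_mul,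
    mul_one] at h2
  rw [degSum] at h
  omega

variable [Fintype V]

/-- Deleting `v` leaves at least (k+1)k in the degree sum on k + 1 vertices, hence a complete graph;
the surplus 2 is the edge at `v`. -/
theorem isTwoCliques_of_pendant {k : ℕ} (hV : Fintype.card V = k + 2) {v : V}
    (hv : inDeg G Finset.univ v ≤ 1) (hD : (k + 1) * k + 2 ≤ degSum G Finset.univ) :
    degSum G Finset.univ = (k + 1) * k + 2 ∧ IsTwoCliques G k := by
  have h1 := degSum_erase (G := G) (Finset.mem_univ v)
  have h2 := degSum_le_card (G := G) (Finset.univ.erase v)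
  have hc : (Finset.univ.erase v).card = k + 1 := by
    rw [Finset.card_erase_of_mem (Finset.mem_univ v), Finset.card_univ, hV]; rfl
  rw [hc] at h2
  have hcl := clique_of_degSum (G := G) (S := Finset.univ.erase v) (by rw [hc]; nlinarith)
  have hv1 : inDeg G Finset.univ v = 1 := by nlinarith
  refine ⟨by nlinarith, ?_⟩
  rw [inDeg, Finset.card_eq_one] at hv1
  obtain ⟨z, hz⟩ := hv1
  have hvz : ∀ y, G.Adj v y ↔ y = z := by
    intro y
    have : y ∈ Finset.univ.filter (G.Adj v) ↔ y ∈ ({z} : Finset V) := by rw [hz]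
    simpa using this
  have hzv : z ≠ v := ((hvz z).2 rfl).ne'
  refine ⟨z, (Finset.univ.erase v).erase z, by simp, ?_, fun x y => ?_⟩
  · rw [Finset.card_erase_of_mem (by simp [hzv]), hc]; rfl
  · have hcl' : ∀ x y, x ≠ v → y ≠ v → x ≠ y → G.Adj x y := fun x y hx hy =>
      hcl x (by simp [hx]) y (by simp [hy])
    by_cases hx : x = v
    · subst hx
      rw [hvz]
      simp only [Finset.mem_erase, Finset.mem_univ, and_true]
      constructor
      · rintro rfl; exact ⟨hzv.symm, by tauto⟩
      · rintro ⟨h1, h2⟩; by_contra h3; have := hzv.symm; have := Ne.symm h1; tauto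
    · by_cases hy : y = v
      · subst hy
        rw [G.adj_comm, hvz]
        simp only [Finset.mem_erase, Finset.mem_univ, and_true]
        constructor
        · rintro rfl; exact ⟨hzv, by tauto⟩
        · rintro ⟨h1, h2⟩; by_contra h3; have := hzv.symm; tauto
      · simp only [Finset.mem_erase, Finset.mem_univ, and_true]
        constructor
        · intro h; exact ⟨h.ne, by tauto⟩
        · rintro ⟨h1, -⟩; exact hcl' x y hx hy h1

/-- Adding a vertex to two cliques sharing a vertex. -/
theorem IsTwoCliques.extend {k x : ℕ} {v : V} (hV : Fintype.card V = k + 2 + (x + 1))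
    (hk : 2 ≤ k) (h : IsTwoCliques (subGraph G (Finset.univ.erase v)) k)
    (hv : inDeg G Finset.univ v = x + 2) :
    (∀ l, 3 ≤ l → l ≤ k + 2 → HasCyc G l) ∨ IsTwoCliques G k := by
  obtain ⟨⟨z, hzS⟩, A₀, hzA₀, hA₀, hadj₀⟩ := h
  have hzv : z ≠ v := by simpa using hzS
  set A : Finset V := A₀.map (Function.Embedding.subtype _) with hA
  have hmem : ∀ y (hy : y ∈ Finset.univ.erase v), y ∈ A ↔ ⟨y, hy⟩ ∈ A₀ := by
    intro y hy; rw [hA]; simp only [Finset.mem_map, Function.Embedding.subtype_apply,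
      Subtype.exists, exists_and_right, exists_eq_right, hy, exists_true_left]
  have hAv : v ∉ A := by
    intro h
    obtain ⟨y, -, hy⟩ := Finset.mem_map.1 h
    have := y.2
    rw [Function.Embedding.subtype_apply] at hy
    rw [hy] at this; simp at this
  have hzA : z ∉ A := by rwa [hmem z hzS]
  have hAc : A.card = k := by rw [hA, Finset.card_map, hA₀]
  have hadj : ∀ y w, y ≠ v → w ≠ v →
      (G.Adj y w ↔ y ≠ w ∧ (y = z ∨ w = z ∨ (y ∈ A ↔ w ∈ A))) := by
    intro y w hy hw
    have hy' : y ∈ Finset.univ.erase v := by simp [hy]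
    have hw' : w ∈ Finset.univ.erase v := by simp [hw]
    have := hadj₀ ⟨y, hy'⟩ ⟨w, hw'⟩
    rw [subGraph_adj, ← hmem, ← hmem] at this
    simpa using this
  set K := insert z A with hK
  have hKv : v ∉ K := by rw [hK, Finset.mem_insert, not_or]; exact ⟨hzv.symm, hAv⟩
  have hKc : K.card = k + 1 := by rw [hK, Finset.card_insert_of_notMem hzA, hAc]
  have hne : ∀ y ∈ K, y ≠ v := by rintro y hy rfl; exact hKv hy
  have hKcl : ∀ y ∈ K, ∀ w ∈ K, y ≠ w → G.Adj y w := by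
    intro y hy w hw hyw
    rw [hadj y w (hne y hy) (hne w hw)]
    rw [hK, Finset.mem_insert] at hy hw
    tauto
  set B := (insert v K)ᶜ with hB
  have hBc : B.card = x + 1 := by
    rw [hB, Finset.card_compl, Finset.card_insert_of_notMem hKv, hKc, hV]; omega
  have hmB : ∀ y, y ∈ B ↔ y ≠ v ∧ y ≠ z ∧ y ∉ A := by
    intro y; rw [hB, Finset.mem_compl, hK]; simp
  -- The clique `K` of order `k + 1` already has all shorter cycles.
  have hext : HasCyc G (k + 2) → ∀ l, 3 ≤ l → l ≤ k + 2 → HasCyc G l := by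
    intro h l hl hlk
    rcases hlk.eq_or_lt with rfl | hlk
    · exact h
    · exact hasCyc_of_clique hKcl hl (by omega)
  by_cases htwo : ∃ p ∈ K, ∃ q ∈ K, p ≠ q ∧ G.Adj v p ∧ G.Adj v q
  · obtain ⟨p, hp, q, hq, hpq, hvp, hvq⟩ := htwo
    obtain ⟨l, hl, hlen, hlK⟩ := exists_path_of_clique hKcl hp hq hpq (j := k + 1) (by omega)
      (by omega)
    left
    apply hext
    have := (hl.cons hvp (fun h => hKv (hlK v h))).cyc hvq.symm (by simp; omega)
    simpa [hlen] using this
  push Not at htwo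
  have hNK : (K.filter (G.Adj v)).card ≤ 1 := by
    rw [Finset.card_le_one]
    intro a ha b hb
    rw [Finset.mem_filter] at ha hb
    by_contra hab
    exact htwo a ha.1 b hb.1 hab ha.2 hb.2
  have hNB : (B.filter (G.Adj v)).card ≤ B.card := Finset.card_filter_le _ _
  -- `B` has `x + 1` vertices and `K` contains at most one neighbour, so degree `x + 2` forces all
  -- of `B` and exactly one `y` in `K`. If `y` is the shared vertex `z`, then `v` joins `B`;
  -- otherwise a path from `y` to `z` through `k` vertices of `K` returns through `B` to `v`.
  have hsplit : inDeg G Finset.univ v ≤ (K.filter (G.Adj v)).card + (B.filter (G.Adj v)).card := by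
    rw [inDeg]
    refine (Finset.card_le_card ?_).trans (Finset.card_union_le _ _)
    intro y hy
    rw [Finset.mem_filter] at hy
    rw [Finset.mem_union, Finset.mem_filter, Finset.mem_filter, hmB, hK, Finset.mem_insert]
    have := hy.2.ne'
    tauto
  have hBall : ∀ y ∈ B, G.Adj v y :=
    Finset.filter_eq_self.1
      (Finset.eq_of_subset_of_card_le (Finset.filter_subset _ _) (by omega))
  obtain ⟨y, hy⟩ := Finset.card_eq_one.1 (show (K.filter (G.Adj v)).card = 1 by omega)
  have hNy : ∀ w ∈ K, (G.Adj v w ↔ w = y) := by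
    intro w hw
    have : w ∈ K.filter (G.Adj v) ↔ w ∈ ({y} : Finset V) := by rw [hy]
    simpa [hw] using this
  have hyK : y ∈ K := by
    have : y ∈ K.filter (G.Adj v) := by rw [hy]; simp
    exact (Finset.mem_filter.1 this).1
  by_cases hyz : y = z
  · right
    subst hyz
    have hvadj : ∀ w, w ≠ v → (G.Adj v w ↔ w = y ∨ w ∉ A) := by
      intro w hw
      by_cases hwK : w ∈ K
      · rw [hNy w hwK]
        rw [hK, Finset.mem_insert] at hwK
        constructor
        · exact .inl
        · rintro (h | h)
          exacts [h, hwK.resolve_right h]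
      · have h1 : w ∉ A := fun h => hwK (Finset.mem_insert_of_mem h)
        have h2 : w ≠ y := by rintro rfl; exact hwK (Finset.mem_insert_self _ _)
        exact iff_of_true (hBall w ((hmB w).2 ⟨hw, h2, h1⟩)) (.inr h1)
    refine ⟨y, A, hzA, hAc, fun a b => ?_⟩
    by_cases ha : a = v
    · subst ha
      by_cases hb : b = a
      · subst hb; simp
      · rw [hvadj b hb]; simp only [hAv, false_iff]; have := Ne.symm hb; tauto
    · by_cases hb : b = v
      · subst hb
        rw [G.adj_comm, hvadj a ha]; simp only [hAv, iff_false]; tauto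
      · exact hadj a b ha hb
  · left
    apply hext
    obtain ⟨w, hw⟩ := Finset.card_pos.1 (show 0 < B.card by omega)
    have hwB := (hmB w).1 hw
    obtain ⟨l, hl, hlen, hlK⟩ := exists_path_of_clique hKcl hyK (Finset.mem_insert_self z A) hyz
      (j := k) (by omega) (by omega)
    have hzw : G.Adj z w := (hadj z w hzv hwB.1).2 ⟨hwB.2.1.symm, .inl rfl⟩
    have hwK : w ∉ K := by rw [hK, Finset.mem_insert]; tauto
    have h1 := hl.concat hzw (fun h => hwK (hlK _ h))
    have h2 := h1.cons (c := v) ((hNy y hyK).2 rfl) (by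
      rw [List.mem_append, List.mem_singleton, not_or]
      exact ⟨fun h => hKv (hlK _ h), hwB.1.symm⟩)
    have := h2.cyc (hBall w hw).symm (by simp; omega)
    simpa [hlen] using this

/-- Adding a vertex to a balanced complete bipartite graph. -/
theorem IsCompleteBip.extend {k : ℕ} {v : V} (hV : Fintype.card V = 2 * k + 1)
    (hk : 2 ≤ k) (h : IsCompleteBip (subGraph G (Finset.univ.erase v)) k)
    (hv : inDeg G Finset.univ v = k) :
    (∀ l, 3 ≤ l → l ≤ k + 2 → HasCyc G l) ∨ IsCompleteBip G k := by
  obtain ⟨A₀, hA₀, hadj₀⟩ := h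
  set A : Finset V := A₀.map (Function.Embedding.subtype _) with hA
  have hmem : ∀ y (hy : y ∈ Finset.univ.erase v), y ∈ A ↔ ⟨y, hy⟩ ∈ A₀ := by
    intro y hy; rw [hA]; simp only [Finset.mem_map, Function.Embedding.subtype_apply,
      Subtype.exists, exists_and_right, exists_eq_right, hy, exists_true_left]
  have hAv : v ∉ A := by
    intro h
    obtain ⟨y, -, hy⟩ := Finset.mem_map.1 h
    have := y.2
    rw [Function.Embedding.subtype_apply] at hy
    rw [hy] at this; simp at this
  have hAc : A.card = k := by rw [hA, Finset.card_map, hA₀]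
  have hadj : ∀ y w, y ≠ v → w ≠ v → (G.Adj y w ↔ (y ∈ A ↔ w ∉ A)) := by
    intro y w hy hw
    have hy' : y ∈ Finset.univ.erase v := by simp [hy]
    have hw' : w ∈ Finset.univ.erase v := by simp [hw]
    have := hadj₀ ⟨y, hy'⟩ ⟨w, hw'⟩
    rwa [subGraph_adj, ← hmem, ← hmem] at this
  set B := (insert v A)ᶜ with hB
  have hmB : ∀ y, y ∈ B ↔ y ≠ v ∧ y ∉ A := by
    intro y; rw [hB, Finset.mem_compl]; simp
  have hBc : B.card = k := by
    rw [hB, Finset.card_compl, Finset.card_insert_of_notMem hAv, hAc, hV]; omega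
  have hAB : Disjoint A B := by
    rw [Finset.disjoint_left]; intro y hy hy'; exact ((hmB y).1 hy').2 hy
  have hjoin : ∀ a ∈ A, ∀ b ∈ B, G.Adj a b := by
    intro a ha b hb
    rw [hmB] at hb
    exact (hadj a b (by rintro rfl; exact hAv ha) hb.1).2 (iff_of_true ha hb.2)
  have hvB : v ∉ B := by simp [hmB]
  have hmemN : ∀ y, y ∈ Finset.univ.filter (G.Adj v) ↔ G.Adj v y := by simp
  by_cases hboth : (∃ α ∈ A, G.Adj v α) ∧ ∃ β ∈ B, G.Adj v β
  · left
    obtain ⟨⟨α, hα, hvα⟩, β, hβ, hvβ⟩ := hboth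
    intro l hl hlk
    rcases Nat.even_or_odd' l with ⟨b, rfl | rfl⟩
    · exact hasCyc_even_of_join hAB hjoin (by omega) (by omega) (by omega)
    · exact hasCyc_odd_of_join hAB hjoin (by omega) (by omega) (by omega) hAv hvB hα hβ hvα hvβ
  right
  -- `v` sees only one side, and its degree `k` is the order of either side.
  have hor : (Finset.univ.filter (G.Adj v)) = A ∨ (Finset.univ.filter (G.Adj v)) = B := by
    by_cases hα : ∃ α ∈ A, G.Adj v α
    · left
      refine Finset.eq_of_subset_of_card_le (fun y hy => ?_) (by rw [hAc, ← hv]; rfl)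
      rw [hmemN] at hy
      by_contra hyA
      exact hboth ⟨hα, y, (hmB y).2 ⟨hy.ne', hyA⟩, hy⟩
    · right
      refine Finset.eq_of_subset_of_card_le (fun y hy => ?_) (by rw [hBc, ← hv]; rfl)
      rw [hmemN] at hy
      exact (hmB y).2 ⟨hy.ne', fun hyA => hα ⟨y, hyA, hy⟩⟩
  rcases hor with hN | hN
  · have hvadj : ∀ y, G.Adj v y ↔ y ∈ A := fun y => by rw [← hmemN, hN]
    refine ⟨A, hAc, fun a b => ?_⟩
    by_cases ha : a = v
    · subst ha; rw [hvadj]; tauto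
    · by_cases hb : b = v
      · subst hb; rw [G.adj_comm, hvadj]; tauto
      · exact hadj a b ha hb
  · have hvadj : ∀ y, G.Adj v y ↔ y ∈ B := fun y => by rw [← hmemN, hN]
    refine ⟨B, hBc, fun a b => ?_⟩
    by_cases ha : a = v
    · subst ha; rw [hvadj]; tauto
    · by_cases hb : b = v
      · subst hb; rw [G.adj_comm, hvadj]; tauto
      · rw [hadj a b ha hb, hmB, hmB]; tauto

/-- Adding a vertex to the join of a clique and an edgeless graph. -/
theorem IsCliqueJoin.extend {t n : ℕ} {v : V} (hV : Fintype.card V = n)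
    (ht : 2 ≤ t) (hn : 2 * t + 1 ≤ n) (h : IsCliqueJoin (subGraph G (Finset.univ.erase v)) t)
    (hv : t ≤ inDeg G Finset.univ v) :
    (∀ l, 3 ≤ l → l ≤ 2 * t + 1 → HasCyc G l) ∨
      (inDeg G Finset.univ v = t ∧ IsCliqueJoin G t) := by
  obtain ⟨A₀, hA₀, hadj₀⟩ := h
  set A : Finset V := A₀.map (Function.Embedding.subtype _) with hA
  have hmem : ∀ y (hy : y ∈ Finset.univ.erase v), y ∈ A ↔ ⟨y, hy⟩ ∈ A₀ := by
    intro y hy; rw [hA]; simp only [Finset.mem_map, Function.Embedding.subtype_apply,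
      Subtype.exists, exists_and_right, exists_eq_right, hy, exists_true_left]
  have hAv : v ∉ A := by
    intro h
    obtain ⟨y, -, hy⟩ := Finset.mem_map.1 h
    have := y.2
    rw [Function.Embedding.subtype_apply] at hy
    rw [hy] at this; simp at this
  have hAc : A.card = t := by rw [hA, Finset.card_map, hA₀]
  have hadj : ∀ y w, y ≠ v → w ≠ v → (G.Adj y w ↔ y ≠ w ∧ (y ∈ A ∨ w ∈ A)) := by
    intro y w hy hw
    have hy' : y ∈ Finset.univ.erase v := by simp [hy]
    have hw' : w ∈ Finset.univ.erase v := by simp [hw]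
    have := hadj₀ ⟨y, hy'⟩ ⟨w, hw'⟩
    rw [subGraph_adj, ← hmem, ← hmem] at this
    simpa using this
  have hneA : ∀ y ∈ A, y ≠ v := by rintro y hy rfl; exact hAv hy
  set B := (insert v A)ᶜ with hB
  have hmB : ∀ y, y ∈ B ↔ y ≠ v ∧ y ∉ A := by
    intro y; rw [hB, Finset.mem_compl]; simp
  have hBc : A.card ≤ B.card := by
    rw [hB, Finset.card_compl, Finset.card_insert_of_notMem hAv, hAc, hV]; omega
  have hAB : Disjoint A B := by
    rw [Finset.disjoint_left]; intro y hy hy'; exact ((hmB y).1 hy').2 hy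
  have hcl : ∀ a ∈ A, ∀ b ∈ A, a ≠ b → G.Adj a b := fun a ha b hb hab =>
    (hadj a b (hneA a ha) (hneA b hb)).2 ⟨hab, .inl ha⟩
  have hjoin : ∀ a ∈ A, ∀ b ∈ B, G.Adj a b := by
    intro a ha b hb
    rw [hmB] at hb
    exact (hadj a b (hneA a ha) hb.1).2 ⟨by rintro rfl; exact hb.2 ha, .inl ha⟩
  have hvB : v ∉ B := by simp [hmB]
  have hmemN : ∀ y, y ∈ Finset.univ.filter (G.Adj v) ↔ G.Adj v y := by simp
  by_cases hw : ∃ w ∈ B, G.Adj v w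
  · left
    obtain ⟨w, hwB, hvw⟩ := hw
    obtain ⟨y, hy, hyw⟩ := exists_mem_ne_of_two_le_card
      (show 2 ≤ (Finset.univ.filter (G.Adj v)).card from ht.trans hv) w
    rw [hmemN] at hy
    intro l hl hlt
    rcases hlt.eq_or_lt with rfl | hlt
    · rw [← hAc]
      exact hasCyc_of_clique_join_of_adj hAB hcl hjoin (by omega) hBc hAv hvB hwB hvw
        (by rw [hmB]; have := hy.ne'; tauto) hyw hy
    · exact hasCyc_of_clique_join hAB hcl hjoin hBc hl (by omega)
  right
  have hsub : Finset.univ.filter (G.Adj v) ⊆ A := by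
    intro y hy
    rw [hmemN] at hy
    by_contra hyA
    exact hw ⟨y, (hmB y).2 ⟨hy.ne', hyA⟩, hy⟩
  have hN := Finset.eq_of_subset_of_card_le hsub (by rw [hAc]; exact hv)
  have hvadj : ∀ y, G.Adj v y ↔ y ∈ A := fun y => by rw [← hmemN, hN]
  refine ⟨by rw [inDeg, hN, hAc], A, hAc, fun a b => ?_⟩
  by_cases ha : a = v
  · subst ha; rw [hvadj]
    exact ⟨fun h => ⟨(hneA b h).symm, .inr h⟩, fun h => h.2.resolve_left hAv⟩
  · by_cases hb : b = v
    · subst hb; rw [G.adj_comm, hvadj]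
      exact ⟨fun h => ⟨hneA a h, .inl h⟩, fun h => h.2.resolve_right hAv⟩
    · exact hadj a b ha hb

/-- The theorem in terms of intrinsic descriptions of the exceptional graphs. -/
theorem hasCyc_or_exceptional {V : Type u} [Fintype V] {G : SimpleGraph V} {k x : ℕ} (hk : 1 ≤ k)
    (hxk : x + 1 ≤ k) (hV : Fintype.card V = k + 2 + x)
    (hD : (k + 1) * k + (x + 2) * (x + 1) ≤ degSum G Finset.univ) :
    (∀ l, 3 ≤ l → l ≤ k + 2 → HasCyc G l) ∨
      (degSum G Finset.univ = (k + 1) * k + (x + 2) * (x + 1) ∧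
        (IsTwoCliques G k ∨ ((k = x + 2 ∨ k = x + 1) ∧ IsCompleteBip G k) ∨
          ∃ t, 2 ≤ t ∧ k + 1 = 2 * t ∧ (t = x + 2 ∨ t = x + 1) ∧ IsCliqueJoin G t)) := by
  induction x generalizing V with
  | zero =>
    by_cases hdeg : ∀ v, 0 + 2 ≤ inDeg G Finset.univ v
    · rcases hasCyc_or_of_inDeg hk hxk hV hdeg hD with h | ⟨h1, ⟨h2, h3⟩ | ⟨h2, h3⟩⟩
      · exact .inl h
      · exact .inr ⟨h1, .inr (.inl ⟨.inl h2, h3⟩)⟩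
      · exact .inr ⟨h1, .inr (.inr ⟨_, le_rfl, h2, .inl rfl, h3⟩)⟩
    · push Not at hdeg
      obtain ⟨v, hv⟩ := hdeg
      obtain ⟨h1, h2⟩ := isTwoCliques_of_pendant hV (v := v) (by omega) hD
      exact .inr ⟨h1, .inl h2⟩
  | succ x ih =>
    by_cases hdeg : ∀ v, x + 1 + 2 ≤ inDeg G Finset.univ v
    · rcases hasCyc_or_of_inDeg hk hxk hV hdeg hD with h | ⟨h1, ⟨h2, h3⟩ | ⟨h2, h3⟩⟩
      · exact .inl h
      · exact .inr ⟨h1, .inr (.inl ⟨.inl h2, h3⟩)⟩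
      · exact .inr ⟨h1, .inr (.inr ⟨_, by omega, h2, .inl rfl, h3⟩)⟩
    · push Not at hdeg
      obtain ⟨v, hv⟩ := hdeg
      have hde := degSum_erase (G := G) (Finset.mem_univ v)
      have hcard := (Fintype.card_coe (Finset.univ.erase v)).trans
        (show (Finset.univ.erase v).card = k + 2 + x by
          rw [Finset.card_erase_of_mem (Finset.mem_univ v), Finset.card_univ, hV]; rfl)
      rcases ih (G := subGraph G (Finset.univ.erase v)) (by omega) hcard
        (by rw [degSum_subGraph]; nlinarith) with h | ⟨h1, h2⟩
      · exact .inl fun l hl hlk => (h l hl hlk).of_subGraph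
      · rw [degSum_subGraph] at h1
        -- At most by the choice of `v`, at least because `G - v` attains its bound.
        have hvd : inDeg G Finset.univ v = x + 2 := by nlinarith
        have hDeq : degSum G Finset.univ = (k + 1) * k + (x + 1 + 2) * (x + 1 + 1) := by
          rw [hde, h1, hvd]; ring
        rcases h2 with h2 | ⟨h2, h3⟩ | ⟨t, h2, h3, h4, h5⟩
        · exact (h2.extend hV (by omega) hvd).imp_right fun h => ⟨hDeq, .inl h⟩
        · have hkx : k = x + 2 := by omega
          exact (h3.extend (by omega) (by omega) (by omega)).imp_right fun h =>
            ⟨hDeq, .inr (.inl ⟨.inr hkx, h⟩)⟩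
        -- The degree of `v` is `x + 2`. If `t = x + 1` this exceeds `t`, so the exceptional
        -- alternative dies; a clique join therefore persists for two consecutive orders only.
        · rcases h5.extend hV h2 (by omega) (by omega) with h | ⟨h6, h7⟩
          · exact .inl fun l hl hlk => h l hl (by omega)
          · exact .inr ⟨hDeq, .inr (.inr ⟨t, h2, h3, .inr (by omega), h7⟩)⟩

end VertexDeletion

/-! ### Identification with the named graphs -/

section Isomorphisms

open scoped Classical

universe u

variable {V : Type u} [Fintype V] {G : SimpleGraph V}

theorem exists_equiv_of_partition {P Q R : Finset V} {a b c : ℕ} (hP : P.card = a)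
    (hQ : Q.card = b) (hR : R.card = c) (hPQ : Disjoint P Q) (hPR : Disjoint P R)
    (hQR : Disjoint Q R) (hV : a + (b + c) = Fintype.card V) :
    ∃ e : Fin a ⊕ (Fin b ⊕ Fin c) ≃ V, (∀ i, e (.inl i) ∈ P) ∧ (∀ i, e (.inr (.inl i)) ∈ Q) ∧
      ∀ i, e (.inr (.inr i)) ∈ R := by
  let f : Fin a ⊕ (Fin b ⊕ Fin c) → V := Sum.elim (fun i => (P.equivFinOfCardEq hP).symm i)
    (Sum.elim (fun i => (Q.equivFinOfCardEq hQ).symm i) fun i => (R.equivFinOfCardEq hR).symm i)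
  have hf1 : ∀ i, f (.inl i) ∈ P := fun i => ((P.equivFinOfCardEq hP).symm i).2
  have hf2 : ∀ i, f (.inr (.inl i)) ∈ Q := fun i => ((Q.equivFinOfCardEq hQ).symm i).2
  have hf3 : ∀ i, f (.inr (.inr i)) ∈ R := fun i => ((R.equivFinOfCardEq hR).symm i).2
  have hinj : Function.Injective f := by
    rw [Finset.disjoint_left] at hPQ hPR hQR
    rintro (i | i | i) (j | j | j) hij
    · simpa [f, Subtype.val_inj] using hij
    · exact absurd (hij ▸ hf2 j) (hPQ (hf1 i))
    · exact absurd (hij ▸ hf3 j) (hPR (hf1 i))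
    · exact absurd (hij ▸ hf2 i) (hPQ (hf1 j))
    · simpa [f, Subtype.val_inj] using hij
    · exact absurd (hij ▸ hf3 j) (hQR (hf2 i))
    · exact absurd (hij ▸ hf3 i) (hPR (hf1 j))
    · exact absurd (hij ▸ hf3 i) (hQR (hf2 j))
    · simpa [f, Subtype.val_inj] using hij
  exact ⟨Equiv.ofBijective f ((Fintype.bijective_iff_injective_and_card f).2
    ⟨hinj, by simpa using hV⟩), hf1, hf2, hf3⟩

theorem IsTwoCliques.iso {k s : ℕ} (h : IsTwoCliques G k) (hV : Fintype.card V = 1 + (k + s)) :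
    Nonempty (G ≃g twoCliquesGraph k s) := by
  obtain ⟨z, A, hzA, hA, hadj⟩ := h
  obtain ⟨e, h1, h2, h3⟩ := exists_equiv_of_partition (P := {z}) (Q := A) (R := (insert z A)ᶜ)
    (Finset.card_singleton z) hA
    (c := s) (by rw [Finset.card_compl, Finset.card_insert_of_notMem hzA]; omega)
    (by simpa using hzA) (by simp)
    (Finset.disjoint_left.2 fun y hy hy' => by simp at hy'; exact hy'.2 hy) hV.symm
  simp only [Finset.mem_singleton, Finset.mem_compl, Finset.mem_insert, not_or] at h1 h3
  refine ⟨(RelIso.symm ⟨e, fun {x y} => ?_⟩)⟩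
  have h2' : ∀ i, e (.inr (.inl i)) ≠ z := fun i hi => hzA (hi ▸ h2 i)
  rw [hadj, e.injective.ne_iff]
  rcases x with x | x | x <;> rcases y with y | y | y <;>
    simp [twoCliquesGraph, graphJoin, h1, h2, h2', h3, hzA]

theorem IsCompleteBip.iso {k m : ℕ} (h : IsCompleteBip G k) (hV : Fintype.card V = k + m) :
    Nonempty (G ≃g completeBipartiteGraph (Fin k) (Fin m)) := by
  obtain ⟨A, hA, hadj⟩ := h
  let eA : Fin k ≃ {x // x ∈ A} := (A.equivFinOfCardEq hA).symm
  let eB : Fin m ≃ {x // x ∉ A} := (Fintype.equivFinOfCardEq (by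
    rw [Fintype.card_subtype_compl, Fintype.card_coe, hA, hV]; omega)).symm
  have hB : ∀ i, (eB i : V) ∉ A := fun i => (eB i).2
  refine ⟨(RelIso.symm ⟨(Equiv.sumCongr eA eB).trans (Equiv.sumCompl (· ∈ A)), fun {x y} => ?_⟩)⟩
  rw [hadj]
  rcases x with x | x <;> rcases y with y | y <;> simp [hB]

/-- Here `k + 2 - 2 * t = 1`, so the middle clique of `kopylovGraph` is a single vertex, and any
vertex outside `T` can play its part. -/
theorem IsCliqueJoin.iso {n k t : ℕ} (h : IsCliqueJoin G t) (hV : Fintype.card V = n)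
    (hk : k + 1 = 2 * t) (hn : k + 2 ≤ n) :
    Nonempty (G ≃g kopylovGraph n (k + 2) t) := by
  obtain ⟨T, hT, hadj⟩ := h
  obtain ⟨w, hw⟩ : ∃ w, w ∉ T := by
    by_contra! hall
    have := Finset.card_eq_iff_eq_univ T |>.2 (Finset.eq_univ_of_forall hall)
    omega
  obtain ⟨e, h1, h2, h3⟩ := exists_equiv_of_partition (P := T) (Q := {w}) (R := (insert w T)ᶜ)
    hT (b := k + 2 - 2 * t) (by rw [Finset.card_singleton]; omega)
    (c := n - (k + 2) + t) (by rw [Finset.card_compl, Finset.card_insert_of_notMem hw]; omega)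
    (by simpa using hw)
    (Finset.disjoint_left.2 fun y hy hy' => by simp at hy'; exact hy'.2 hy)
    (by simp) (by omega)
  simp only [Finset.mem_singleton, Finset.mem_compl, Finset.mem_insert, not_or] at h2 h3
  have hsub : ∀ x y : Fin (k + 2 - 2 * t), x = y := fun x y => Fin.ext (by omega)
  refine ⟨(RelIso.symm ⟨e, fun {x y} => ?_⟩)⟩
  rw [hadj, e.injective.ne_iff]
  rcases x with x | x | x <;> rcases y with y | y | y <;>
    simp [kopylovGraph, graphJoin, h1, h2, h3, hw]
  exact hsub x y

theorem two_mul_card_edgeFinset [Fintype G.edgeSet] :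
    2 * G.edgeFinset.card = degSum G Finset.univ := by
  have h := G.sum_degrees_eq_twice_card_edges
  rw [degSum]
  convert h.symm using 2
  · congr!
  · rw [inDeg, ← card_neighborFinset_eq_degree, neighborFinset_eq_filter]

theorem two_mul_choose_two (m : ℕ) : 2 * (m + 1).choose 2 = (m + 1) * m := by
  rw [Nat.choose_two_right, Nat.add_sub_cancel, Nat.mul_div_cancel']
  rw [mul_comm]
  exact (Nat.even_mul_succ_self m).two_dvd

end Isomorphisms

theorem lemma3p1 {V : Type*} [Fintype V] (G : SimpleGraph V) [Fintype G.edgeSet] (n k : ℕ)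
    (hn : Fintype.card V = n) (hk : 3 ≤ k + 2) (hkn : k + 2 ≤ n) (hnk : n ≤ 2 * k + 1)
    (hG : (k + 1).choose 2 + (n - k).choose 2 ≤ G.edgeFinset.card) :
    (∀ l : ℕ, 3 ≤ l → l ≤ k + 2 → HasCycleOfLength G l) ∨
      (Nonempty (G ≃g twoCliquesGraph k (n - k - 1)) ∨
        Nonempty (G ≃g completeBipartiteGraph (Fin k) (Fin k)) ∨
        Nonempty (G ≃g completeBipartiteGraph (Fin k) (Fin (k + 1)))) ∨
      (Odd k ∧ 3 ≤ k ∧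
        (Nonempty (G ≃g kopylovGraph ((3 * k + 1) / 2) (k + 2) ((k + 1) / 2)) ∨
          Nonempty (G ≃g kopylovGraph ((3 * k + 3) / 2) (k + 2) ((k + 1) / 2)))) := by
  obtain ⟨x, rfl⟩ := Nat.exists_eq_add_of_le hkn
  have h1 := two_mul_card_edgeFinset (G := G)
  have h2 := two_mul_choose_two k
  have h3 := two_mul_choose_two (x + 1)
  rw [show k + 2 + x - k = x + 1 + 1 by omega] at hG
  rcases hasCyc_or_exceptional (G := G) (k := k) (x := x) (by omega) (by omega) hn (by
      rw [show x + 2 = x + 1 + 1 from rfl]; omega) with h | ⟨-, h | ⟨h | h, h'⟩ | ⟨t, ht, hkt, h, h'⟩⟩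
  · exact .inl fun l hl hlk => (h l hl hlk).hasCycleOfLength
  · exact .inr (.inl (.inl (h.iso (by omega))))
  · exact .inr (.inl (.inr (.inl (h'.iso (by omega)))))
  · exact .inr (.inl (.inr (.inr (h'.iso (by omega)))))
  · obtain rfl : k = 2 * t - 1 := by omega
    refine .inr (.inr ⟨⟨t - 1, by omega⟩, by omega, ?_⟩)
    rw [show (2 * t - 1 + 1) / 2 = t by omega]
    -- With `k = 2 * t - 1`, the cases `t = x + 2` and `t = x + 1` give the orders 3t - 1 and 3t.
    rcases h with h | h
    · exact .inl (h'.iso (by omega) hkt (by omega))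
    · exact .inr (h'.iso (by omega) hkt (by omega))
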